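/- All Hilbert spaces are finite dimensional and all logarithms are to base 2. For states $\rho,\sigma$ let $\mathrm{F}(\rho,\sigma)=\|\sqrt\rho\sqrt\sigma\|_1$ and $\mathrm{P}(\rho,\sigma)=\sqrt{1-\mathrm{F}(\rho,\sigma)^2}$, and let $\mathcal{B}^{\varepsilon}(\rho)$ be the set of states $\rho'$ with $\mathrm{P}(\rho,\rho')\le\varepsilon$. Let $$\mathrm{D}_{\max}(\rho\|\sigma)=\inf\{\lambda\in\mathbb{R}:\rho\le 2^{\lambda}\sigma\},\qquad \mathrm{D}^{\varepsilon}_{\max}(\rho\|\sigma)=\inf_{\rho'\in\mathcal{B}^{\varepsilon}(\rho)}\mathrm{D}_{\max}(\rho'\|\sigma),$$ $$\mathrm{D}^{\varepsilon}_{\mathrm{H}}(\rho\|\sigma)=\sup_{0\le\Pi\le \mathrm{I},\ \mathrm{Tr}(\Pi\rho)\ge 1-\varepsilon}\log\frac{1}{\mathrm{Tr}(\Pi\sigma)},$$ where an infimum over the empty set is $+\infty$ and a supremum over the empty set is $-\infty$. A $(q,\eta)$-quantum state redistribution protocol $\mathcal{P}$ for a (possibly mixed) state $\Psi_{RABC}$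 consists of a pure state $|\theta\rangle_{E_AE_B}$ shared by Alice ($E_A$) and Bob ($E_B$), an isometry $V:\mathcal{H}_{ACE_A}\to\mathcal{H}_{AQT_A}$ of Alice and an isometry $W:\mathcal{H}_{QBE_B}\to\mathcal{H}_{BCT_B}$ of Bob, with $q=\log|Q|$, such that $$\mathrm{P}\big(\mathrm{Tr}_{T_AT_B}(WV(\Psi_{RABC}\otimes\theta_{E_AE_B})V^\dagger W^\dagger),\,\Psi_{RABC}\big)\le\eta .$$ An $(N,\varepsilon')$-QSR simulation that makes one use of $\mathcal{P}$ consists of the following, where $N\in\mathbb{R}$ and the messages are the integers $m\in[1:2^N]$. - A pure state $|\omega\rangle_{S_AS_B}=|\theta\rangle_{E_AE_B}\otimes|\varphi\rangle$, pre-shared between Alice ($S_A$) and Bob ($S_B$). Alice's part of $|\varphi\rangle$ consists of finitely many pairs of registers, each pair a copy of $AC$, and of a further register; Bob's part is an arbitrary register. - For every message $m$, a choice of one of these pairs, $A(m)C(m)$, such that the reduced state of $\omega$ on $A(m)C(m)$ is $\Psi_{AC}$. To send $m$, Alice applies $V$ to $A(m)C(m)E_A$ and sends the resulting register $Q$ to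 Bob. - A completely positive trace preserving map $\mathcal{D}:\mathcal{L}(S_BQ)\to\mathcal{L}(M')$ of Bob, where $M'$ has an orthonormal basis labelled by the messages and one additional symbol for failure, such that measuring $M'$ in this basis gives $\Pr[M'\ne m\mid M=m]\le\varepsilon'$ for every message $m$. **Proposition.** Let $\varepsilon,\delta\in(0,1)$, let $\Psi_{RABC}$ be a quantum state, and let $\mathcal{P}$ be a $(q,\eta)$-quantum state redistribution protocol for $\Psi_{RABC}$. Then for every real $N$ with $$N\le \mathrm{D}_{\mathrm{H}}^{\varepsilon-3\sqrt{\delta}-3\eta}(\Psi_{RBC}\|\Psi_R\otimes\Psi_{BC})-\mathrm{D}_{\max}^{\sqrt{\delta}}(\Psi_{RB}\|\Psi_R\otimes\Psi_B)-\log\frac{4\varepsilon^3}{\delta^4}$$ there exists an $(N,\varepsilon+2\delta)$-QSR simulation that makes one use of $\mathcal{P}$. -/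

import Mathlib

open scoped Kronecker Matrix ComplexOrder

universe u

noncomputable section

namespace QSR

/-! A finite-dimensional register is given by a finite type labelling an orthonormal basis of its
Hilbert space; operators are complex matrices, and the composition of registers is the product of
the label types. All logarithms are to base 2. -/

/-! ### States, marginals, maps -/

/-- Density matrices: positive semidefinite of trace one. -/
structure IsState {X : Type*} [Fintype X] (ρ : Matrix X X ℂ) : Prop where
  posSemidef : ρ.PosSemidef
  trace_eq_one : ρ.trace = 1

/-- The operator `|ψ⟩⟨ψ|`. -/
def ketbra {X : Type*} (ψ : X → ℂ) : Matrix X X ℂ :=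
  Matrix.vecMulVec ψ (star ψ)

/-- `|ψ⟩` is a unit vector. -/
def IsUnitVector {X : Type*} [Fintype X] (ψ : X → ℂ) : Prop :=
  star ψ ⬝ᵥ ψ = 1

/-- Partial trace: `glue` composes a label of the register that is kept with a label of the register
that is traced out to a label of the whole system. -/
def marginal {X K D : Type*} [Fintype D] (glue : K → D → X) (ρ : Matrix X X ℂ) : Matrix K K ℂ :=
  Matrix.of fun k k' => ∑ d, ρ (glue k d) (glue k' d)

/-- `V` is an isometry from the Hilbert space of `X` to that of `Y`. -/
def IsIsometry {X Y : Type*} [DecidableEq X] [Fintype Y] (V : Matrix Y X ℂ) : Prop :=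
  Vᴴ * V = 1

/-- `V` acting on register `X`, while register `Z` is left untouched:
`(V ⊗ I) ρ (V ⊗ I)†`. -/
def applyLeft {X Y Z : Type*} [Fintype X] [Fintype Z] [DecidableEq Z]
    (V : Matrix Y X ℂ) (ρ : Matrix (X × Z) (X × Z) ℂ) : Matrix (Y × Z) (Y × Z) ℂ :=
  (V ⊗ₖ (1 : Matrix Z Z ℂ)) * ρ * (V ⊗ₖ (1 : Matrix Z Z ℂ))ᴴ

/-- The map `id_k ⊗ E` on `k × k` block matrices. -/
def blockMap {X Y : Type*} (E : Matrix X X ℂ →ₗ[ℂ] Matrix Y Y ℂ) (k : ℕ)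
    (M : Matrix (Fin k × X) (Fin k × X) ℂ) : Matrix (Fin k × Y) (Fin k × Y) ℂ :=
  Matrix.of fun p p' => E (Matrix.of fun x x' => M (p.1, x) (p'.1, x')) p.2 p'.2

/-- Quantum maps: completely positive and trace preserving. -/
structure IsQuantumMap {X Y : Type*} [Fintype X] [Fintype Y]
    (E : Matrix X X ℂ →ₗ[ℂ] Matrix Y Y ℂ) : Prop where
  completelyPositive : ∀ (k : ℕ) (M : Matrix (Fin k × X) (Fin k × X) ℂ),
    M.PosSemidef → (blockMap E k M).PosSemidef
  tracePreserving : ∀ M : Matrix X X ℂ, (E M).trace = M.trace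

/-! ### Fidelity and divergences -/

open scoped MatrixOrder in
/-- Trace norm `Tr √(X† X)`. -/
def traceNorm {X : Type*} [Fintype X] [DecidableEq X] (M : Matrix X X ℂ) : ℝ :=
  (CFC.sqrt (Mᴴ * M)).trace.re

open scoped MatrixOrder in
/-- Fidelity `‖√ρ √σ‖₁`. -/
def fidelity {X : Type*} [Fintype X] [DecidableEq X] (ρ σ : Matrix X X ℂ) : ℝ :=
  traceNorm (CFC.sqrt ρ * CFC.sqrt σ)

/-- Purified distance. -/
def purifiedDistance {X : Type*} [Fintype X] [DecidableEq X] (ρ σ : Matrix X X ℂ) : ℝ :=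
  √(1 - fidelity ρ σ ^ 2)

/-- The `ε`-ball of states around `ρ`. -/
def ball {X : Type*} [Fintype X] [DecidableEq X] (ε : ℝ) (ρ : Matrix X X ℂ) :
    Set (Matrix X X ℂ) :=
  {ρ' | IsState ρ' ∧ purifiedDistance ρ ρ' ≤ ε}

/-- Max-relative entropy; it is `⊤` if the support of `ρ` is not contained in that of `σ`. -/
def Dmax {X : Type*} [Fintype X] (ρ σ : Matrix X X ℂ) : EReal :=
  sInf {l : EReal | ∃ t : ℝ, l = (t : EReal) ∧
    ((((2 : ℝ) ^ t : ℝ) : ℂ) • σ - ρ).PosSemidef}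

/-- Smooth max-relative entropy: the least max-relative entropy over the `ε`-ball. -/
def smoothDmax {X : Type*} [Fintype X] [DecidableEq X] (ε : ℝ) (ρ σ : Matrix X X ℂ) : EReal :=
  ⨅ ρ' ∈ ball ε ρ, Dmax ρ' σ

/-- `log (1 / x)` for `x ≥ 0`, equal to `⊤` at `x = 0`. -/
def logInv (x : ℝ) : EReal :=
  if x ≤ 0 then ⊤ else ((Real.logb 2 (1 / x) : ℝ) : EReal)

/-- Smooth hypothesis testing divergence: the supremum of `log (1 / Tr (T σ))` over all tests
`0 ≤ T ≤ I` with `Tr (T ρ) ≥ 1 - ε`. It is `⊥` if there is no such test (that is, if `ε < 0`). -/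
def DH {X : Type*} [Fintype X] [DecidableEq X] (ε : ℝ) (ρ σ : Matrix X X ℂ) : EReal :=
  sSup {l : EReal | ∃ T : Matrix X X ℂ, T.PosSemidef ∧ (1 - T).PosSemidef ∧
    1 - ε ≤ (T * ρ).trace.re ∧ l = logInv (T * σ).trace.re}

/-! ### Marginals of a state on `RABC` -/

section Marginals

variable {R A B C : Type*} [Fintype R] [Fintype A] [Fintype B] [Fintype C]

def margR (Ψ : Matrix (R × A × B × C) (R × A × B × C) ℂ) : Matrix R R ℂ :=
  marginal (fun r (d : A × B × C) => (r, d.1, d.2.1, d.2.2)) Ψ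

def margB (Ψ : Matrix (R × A × B × C) (R × A × B × C) ℂ) : Matrix B B ℂ :=
  marginal (fun b (d : R × A × C) => (d.1, d.2.1, b, d.2.2)) Ψ

def margBC (Ψ : Matrix (R × A × B × C) (R × A × B × C) ℂ) : Matrix (B × C) (B × C) ℂ :=
  marginal (fun x (d : R × A) => (d.1, d.2, x.1, x.2)) Ψ

def margRB (Ψ : Matrix (R × A × B × C) (R × A × B × C) ℂ) : Matrix (R × B) (R × B) ℂ :=
  marginal (fun x (d : A × C) => (x.1, d.1, x.2, d.2)) Ψ

def margAC (Ψ : Matrix (R × A × B × C) (R × A × B × C) ℂ) : Matrix (A × C) (A × C) ℂ :=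
  marginal (fun x (d : R × B) => (d.1, x.1, d.2, x.2)) Ψ

def margRBC (Ψ : Matrix (R × A × B × C) (R × A × B × C) ℂ) :
    Matrix (R × B × C) (R × B × C) ℂ :=
  marginal (fun x (a : A) => (x.1, a, x.2.1, x.2.2)) Ψ

end Marginals

/-! ### Quantum state redistribution -/

section Redistribution

variable {R A B C : Type u} [Fintype R] [Fintype A] [Fintype B] [Fintype C]
  [DecidableEq R] [DecidableEq A] [DecidableEq B] [DecidableEq C]

/-- The final state on `RABC` when Alice applies `V : A C E_A → A Q T_A` and Bob then applies
`W : Q B E_B → B C T_B` to `Ψ_{RABC} ⊗ θ_{E_A E_B}`, and `T_A T_B` is traced out. -/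
def finalState {EA EB Q TA TB : Type u} [Fintype EA] [Fintype EB] [Fintype Q] [Fintype TA]
    [Fintype TB] [DecidableEq EB] [DecidableEq TA]
    (V : Matrix (A × Q × TA) (A × C × EA) ℂ) (W : Matrix (B × C × TB) (Q × B × EB) ℂ)
    (θ : EA × EB → ℂ) (Ψ : Matrix (R × A × B × C) (R × A × B × C) ℂ) :
    Matrix (R × A × B × C) (R × A × B × C) ℂ :=
  let start : Matrix ((A × C × EA) × (R × B × EB)) ((A × C × EA) × (R × B × EB)) ℂ :=
    (Ψ ⊗ₖ ketbra θ).submatrix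
      (fun x => ((x.2.1, x.1.1, x.2.2.1, x.1.2.1), (x.1.2.2, x.2.2.2)))
      (fun x => ((x.2.1, x.1.1, x.2.2.1, x.1.2.1), (x.1.2.2, x.2.2.2)))
  let sent : Matrix ((Q × B × EB) × (R × A × TA)) ((Q × B × EB) × (R × A × TA)) ℂ :=
    (applyLeft V start).submatrix
      (fun x => ((x.2.2.1, x.1.1, x.2.2.2), (x.2.1, x.1.2.1, x.1.2.2)))
      (fun x => ((x.2.2.1, x.1.1, x.2.2.2), (x.2.1, x.1.2.1, x.1.2.2)))
  marginal
    (fun (x : R × A × B × C) (t : TA × TB) =>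
      ((x.2.2.1, x.2.2.2, t.2), (x.1, x.2.1, t.1)))
    (applyLeft W sent)

/-- A `(q, η)`-quantum state redistribution protocol for `Ψ_{RABC}`. -/
structure Protocol (Ψ : Matrix (R × A × B × C) (R × A × B × C) ℂ) (q η : ℝ) where
  /-- Alice's and Bob's parts of the pre-shared entanglement, the message, and the registers that
  Alice and Bob discard. -/
  (EA EB Q TA TB : Type u)
  [fintypeEA : Fintype EA] [fintypeEB : Fintype EB] [fintypeQ : Fintype Q]
  [fintypeTA : Fintype TA] [fintypeTB : Fintype TB]
  [decEqEA : DecidableEq EA] [decEqEB : DecidableEq EB] [decEqQ : DecidableEq Q]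
  [decEqTA : DecidableEq TA] [decEqTB : DecidableEq TB]
  /-- The pre-shared entangled pure state. -/
  θ : EA × EB → ℂ
  θ_unit : IsUnitVector θ
  /-- Alice's encoding isometry. -/
  V : Matrix (A × Q × TA) (A × C × EA) ℂ
  V_isometry : IsIsometry V
  /-- Bob's decoding isometry. -/
  W : Matrix (B × C × TB) (Q × B × EB) ℂ
  W_isometry : IsIsometry W
  /-- The number of qubits communicated. -/
  communication : q = Real.logb 2 (Fintype.card Q)
  error_le : purifiedDistance (finalState V W θ Ψ) Ψ ≤ η

attribute [instance] Protocol.fintypeEA Protocol.fintypeEB Protocol.fintypeQ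
  Protocol.fintypeTA Protocol.fintypeTB Protocol.decEqEA Protocol.decEqEB Protocol.decEqQ
  Protocol.decEqTA Protocol.decEqTB

/-! ### Entanglement-assisted classical communication by one use of a protocol -/

/-- The number of integers in `[1 : 2^N]`. -/
def numMessages (N : ℝ) : ℕ := ⌊(2 : ℝ) ^ N⌋₊

/-- Alice and Bob share `θ_{E_A E_B} ⊗ φ`, where Alice's part of `φ` consists of registers
`A(i) C(i)`, for `i : Slot`, and of `G`, and Bob's part of `φ` is `F`. Alice runs her side of the
protocol on `A(s) C(s) E_A` and sends `Q`. The result is the state of Bob's registers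
`S_B = E_B F` and `Q`. -/
def Protocol.received {Ψ : Matrix (R × A × B × C) (R × A × B × C) ℂ} {q η : ℝ}
    (P : Protocol Ψ q η) {Slot : Type} {G F : Type u} [Fintype Slot] [DecidableEq Slot]
    [Fintype G] [DecidableEq G] [Fintype F] [DecidableEq F]
    (φ : ((Slot → A × C) × G) × F → ℂ) (s : Slot) :
    Matrix ((P.EB × F) × P.Q) ((P.EB × F) × P.Q) ℂ :=
  let start : Matrix
      ((A × C × P.EA) × (({i : Slot // i ≠ s} → A × C) × G) × (P.EB × F))
      ((A × C × P.EA) × (({i : Slot // i ≠ s} → A × C) × G) × (P.EB × F)) ℂ :=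
    (ketbra P.θ ⊗ₖ ketbra φ).submatrix
      (fun x => ((x.1.2.2, x.2.2.1),
        (((Equiv.funSplitAt s (A × C)).symm ((x.1.1, x.1.2.1), x.2.1.1), x.2.1.2), x.2.2.2)))
      (fun x => ((x.1.2.2, x.2.2.1),
        (((Equiv.funSplitAt s (A × C)).symm ((x.1.1, x.1.2.1), x.2.1.1), x.2.1.2), x.2.2.2)))
  marginal
    (fun (y : (P.EB × F) × P.Q)
        (d : (A × P.TA) × (({i : Slot // i ≠ s} → A × C) × G)) =>
      ((d.1.1, y.2, d.1.2), (d.2, y.1)))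
    (applyLeft P.V start)

/-- An `(N, ε)`-QSR simulation that makes one use of the protocol `P` for `Ψ_{RABC}`. The pre-shared
entanglement of the simulation is the pure state `θ ⊗ φ`, where `θ` is the one required by `P`. -/
structure Simulation {Ψ : Matrix (R × A × B × C) (R × A × B × C) ℂ} {q η : ℝ}
    (P : Protocol Ψ q η) (N ε : ℝ) where
  /-- Labels of Alice's registers `A(i) C(i)`. -/
  Slot : Type
  /-- Further registers of Alice and of Bob. -/
  (G F : Type u)
  [fintypeSlot : Fintype Slot] [fintypeG : Fintype G] [fintypeF : Fintype F]
  [decEqSlot : DecidableEq Slot] [decEqG : DecidableEq G] [decEqF : DecidableEq F]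
  /-- The pre-shared entangled pure state, besides `θ`. -/
  φ : ((Slot → A × C) × G) × F → ℂ
  φ_unit : IsUnitVector φ
  /-- The registers that Alice chooses for each message. -/
  slot : Fin (numMessages N) → Slot
  /-- The chosen registers hold the state `Ψ_{AC}`. -/
  slot_state : ∀ m,
    marginal
      (fun (x : A × C) (d : (({i : Slot // i ≠ slot m} → A × C) × G) × F) =>
        (((Equiv.funSplitAt (slot m) (A × C)).symm (x, d.1.1), d.1.2), d.2))
      (ketbra φ) = margAC Ψ
  /-- Bob's decoding map to a register `M'`, which has a basis vector for each message and one for a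
  declared failure. -/
  decode : Matrix ((P.EB × F) × P.Q) ((P.EB × F) × P.Q) ℂ →ₗ[ℂ]
    Matrix (Option (Fin (numMessages N))) (Option (Fin (numMessages N))) ℂ
  decode_quantumMap : IsQuantumMap decode
  /-- `Pr[M' ≠ m | M = m] ≤ ε`. -/
  error_le : ∀ m : Fin (numMessages N),
    ∑ k : Option (Fin (numMessages N)) with k ≠ some m,
      (decode (P.received φ (slot m)) k k).re ≤ ε

end Redistribution

end QSR

end

/-!
Alice and Bob share one copy of the canonical purification of `Ψ` for each message: Alice holds
every `AC` and every purifying register, Bob holds every `RB`. For the message `m` Alice encodes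
with the `AC` of copy `m`. Bob then holds a state in which `Q E_B` is correlated with slot `m` only,
and his task is to find that slot.

Position-based decoding (`exists_slot_decoder`) reduces this to one test `T` of `Q E_B` and one copy
of `RB`, which has to accept the encoded state `τ` and to reject the product of its marginals. The
pretty good measurement built from `T` is controlled by the Hayashi–Nagaoka inequality
(`one_sub_inv_sqrt_mul_mul_le`).

The test comes from an optimal test `E` for `Ψ_RBC` against `Ψ_R ⊗ Ψ_BC`, in three moves.

* `exists_universal_test`: on `BC`, a contraction suppresses the part on which `E` accepts `Ψ_R` too
  often. The new test rejects `Ψ_R ⊗ σ` for *every* state `σ` of `BC`. This costs a factor `1 / δ`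
  in the error of the second kind and `√δ` in that of the first kind.
* `exists_bobOut_test`: the test is pulled back through Bob's decoding isometry to a test of `Q E_B`
  and `R B`. It still accepts `τ` up to `η`, as the protocol ends near `Ψ`, and it rejects
  `τ_{Q E_B} ⊗ Ψ_R ⊗ Ψ_B`, as this is mapped to some `Ψ_R ⊗ σ`.
* `exists_smoothed_test`: a state `ρ'` near `Ψ_RB` satisfies `ρ' ≤ 2^t Ψ_R ⊗ Ψ_B`. Closeness in
  fidelity gives `Ψ_RB ≤ 4 ρ' + Δ` with `Tr Δ` of order `δ` (`exists_le_four_smul_add`), and a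
  contraction that is nearly the identity on `Ψ_RB` moves it below `4 ρ'`
  (`exists_contraction_of_le_add`). This costs a factor `4 · 2^t` and `2 √δ`.

Every change of a test by a contraction is controlled by `gentle_contraction`, which, like the bound
of test probabilities by the purified distance, follows from the fact that a two-outcome measurement
does not decrease an overlap (`overlap_sq_add_test_sq_le`).
-/

namespace QSR

open scoped MatrixOrder

/-! ### Operator inequalities, overlaps and contractions -/

section MatrixInequalities

set_option linter.unusedSectionVars false

variable {n m : Type*} [Fintype n] [Fintype m]

theorem trace_conjTranspose_re (A : Matrix n n ℂ) : (Aᴴ).trace.re = A.trace.re := by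
  rw [Matrix.trace_conjTranspose]; simp

theorem trace_re_nonneg {A : Matrix n n ℂ} (hA : 0 ≤ A) : 0 ≤ A.trace.re :=
  (Complex.le_def.1 (Matrix.nonneg_iff_posSemidef.1 hA).trace_nonneg).1

theorem trace_re_mono {A B : Matrix n n ℂ} (h : A ≤ B) : A.trace.re ≤ B.trace.re := by
  have := trace_re_nonneg (sub_nonneg.2 h)
  simpa [Matrix.trace_sub] using this

theorem conjTranspose_mul_self_nonneg (A : Matrix m n ℂ) : 0 ≤ Aᴴ * A :=
  Matrix.nonneg_iff_posSemidef.2 (Matrix.posSemidef_conjTranspose_mul_self A)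

theorem self_mul_conjTranspose_nonneg (A : Matrix m n ℂ) : 0 ≤ A * Aᴴ :=
  Matrix.nonneg_iff_posSemidef.2 (Matrix.posSemidef_self_mul_conjTranspose A)

theorem mul_mul_conjTranspose_mono {A B : Matrix n n ℂ} (h : A ≤ B) (K : Matrix m n ℂ) :
    K * A * Kᴴ ≤ K * B * Kᴴ := by
  have := (Matrix.le_iff.1 h).mul_mul_conjTranspose_same K
  rw [Matrix.le_iff]
  simpa [Matrix.mul_sub, Matrix.sub_mul] using this

theorem conjTranspose_mul_mul_mono {A B : Matrix n n ℂ} (h : A ≤ B) (K : Matrix n m ℂ) :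
    Kᴴ * A * K ≤ Kᴴ * B * K := by
  simpa using mul_mul_conjTranspose_mono h Kᴴ

theorem kronecker_mono_right {A : Matrix n n ℂ} {B C : Matrix m m ℂ} (hA : 0 ≤ A) (h : B ≤ C) :
    A ⊗ₖ B ≤ A ⊗ₖ C := by
  classical
  have := (Matrix.nonneg_iff_posSemidef.1 hA).kronecker (Matrix.le_iff.1 h)
  rw [Matrix.le_iff]
  convert this using 1
  ext i j
  simp [mul_sub]

theorem kronecker_mono_left {A B : Matrix n n ℂ} {C : Matrix m m ℂ} (h : A ≤ B) (hC : 0 ≤ C) :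
    A ⊗ₖ C ≤ B ⊗ₖ C := by
  classical
  have := (Matrix.le_iff.1 h).kronecker (Matrix.nonneg_iff_posSemidef.1 hC)
  rw [Matrix.le_iff]
  convert this using 1
  ext i j
  simp [sub_mul]

theorem smul_le_smul_matrix {A B : Matrix n n ℂ} (h : A ≤ B) {c : ℝ} (hc : 0 ≤ c) :
    (c : ℂ) • A ≤ (c : ℂ) • B := by
  have := (Matrix.le_iff.1 h).smul (a := (c : ℂ)) (by exact_mod_cast hc)
  rw [Matrix.le_iff]
  rwa [smul_sub] at this

theorem smul_matrix_nonneg {A : Matrix n n ℂ} (h : 0 ≤ A) {c : ℝ} (hc : 0 ≤ c) :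
    0 ≤ (c : ℂ) • A := by
  simpa using smul_le_smul_matrix h hc

theorem conjTranspose_eq_of_nonneg {A : Matrix n n ℂ} (h : 0 ≤ A) : Aᴴ = A :=
  (Matrix.nonneg_iff_posSemidef.1 h).1

variable [DecidableEq n] [DecidableEq m]

theorem sqrt_mul_sqrt {A : Matrix n n ℂ} (h : 0 ≤ A) : CFC.sqrt A * CFC.sqrt A = A :=
  CFC.sqrt_mul_sqrt_self A h

theorem sqrt_conjTranspose (A : Matrix n n ℂ) : (CFC.sqrt A)ᴴ = CFC.sqrt A :=
  conjTranspose_eq_of_nonneg (CFC.sqrt_nonneg A)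

section
open scoped Matrix.Norms.L2Operator

/-- Operator monotonicity of the square root; the operator norm only serves to make the matrices a
C⋆-algebra. -/
theorem sqrt_mono {A B : Matrix n n ℂ} (h : A ≤ B) : CFC.sqrt A ≤ CFC.sqrt B :=
  CFC.sqrt_le_sqrt A B h
end

theorem one_nonneg_matrix : (0 : Matrix n n ℂ) ≤ 1 :=
  Matrix.nonneg_iff_posSemidef.2 Matrix.PosSemidef.one

theorem trace_mul_re_nonneg {A B : Matrix n n ℂ} (hA : 0 ≤ A) (hB : 0 ≤ B) :
    0 ≤ (A * B).trace.re := by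
  rw [← sqrt_mul_sqrt hA, Matrix.mul_assoc, Matrix.trace_mul_comm]
  refine trace_re_nonneg ?_
  simpa [sqrt_conjTranspose] using mul_mul_conjTranspose_mono hB (CFC.sqrt A)

theorem trace_mul_re_mono_right {A B C : Matrix n n ℂ} (hA : 0 ≤ A) (h : B ≤ C) :
    (A * B).trace.re ≤ (A * C).trace.re := by
  have := trace_mul_re_nonneg hA (sub_nonneg.2 h)
  simpa [Matrix.mul_sub, Matrix.trace_sub] using this

theorem trace_mul_re_mono_left {A B C : Matrix n n ℂ} (h : A ≤ B) (hC : 0 ≤ C) :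
    (A * C).trace.re ≤ (B * C).trace.re := by
  have := trace_mul_re_nonneg (sub_nonneg.2 h) hC
  simpa [Matrix.sub_mul, Matrix.trace_sub] using this

/-- The Cauchy–Schwarz inequality for the Hilbert–Schmidt inner product. -/
theorem re_trace_conjTranspose_mul_sq_le (X Y : Matrix n m ℂ) :
    (Xᴴ * Y).trace.re ^ 2 ≤ (Xᴴ * X).trace.re * (Yᴴ * Y).trace.re := by
  have key : ∀ t : ℝ, 0 ≤ (Yᴴ * Y).trace.re * (t * t) + 2 * (Xᴴ * Y).trace.re * t
      + (Xᴴ * X).trace.re := by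
    intro t
    have h := trace_re_nonneg (conjTranspose_mul_self_nonneg (X + (t : ℂ) • Y))
    have h2 : (Yᴴ * X).trace.re = (Xᴴ * Y).trace.re := by
      rw [← trace_conjTranspose_re]; simp
    simp only [Matrix.conjTranspose_add, Matrix.conjTranspose_smul, Matrix.add_mul, Matrix.mul_add,
      Matrix.trace_add, Complex.add_re, Matrix.smul_mul, Matrix.mul_smul, Matrix.trace_smul,
      smul_eq_mul, Complex.star_def, Complex.conj_ofReal, Complex.re_ofReal_mul, h2] at h
    linarith
  have := discrim_le_zero key
  rw [discrim] at this
  nlinarith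

/-- Any two-outcome test coarse-grains an overlap: `p` and `r` are the probabilities that the two
(possibly subnormalised) states with purifications `X` and `Y` pass the test `T`. -/
theorem overlap_sq_add_test_sq_le {T : Matrix n n ℂ} (hT : 0 ≤ T) (hT1 : T ≤ 1)
    {X Y : Matrix n m ℂ} (hX : (X * Xᴴ).trace.re ≤ 1) (hY : (Y * Yᴴ).trace.re ≤ 1) :
    (Xᴴ * Y).trace.re ^ 2 + ((T * (X * Xᴴ)).trace.re - (T * (Y * Yᴴ)).trace.re) ^ 2 ≤ 1 := by
  set L := CFC.sqrt T
  set K := CFC.sqrt (1 - T)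
  have hL : Lᴴ * L = T := by rw [sqrt_conjTranspose, sqrt_mul_sqrt hT]
  have hK : Kᴴ * K = 1 - T := by rw [sqrt_conjTranspose, sqrt_mul_sqrt (sub_nonneg.2 hT1)]
  have cs1 := re_trace_conjTranspose_mul_sq_le (L * X) (L * Y)
  have cs2 := re_trace_conjTranspose_mul_sq_le (K * X) (K * Y)
  have e : ∀ (J : Matrix n n ℂ) (A B : Matrix n m ℂ),
      ((J * A)ᴴ * (J * B)).trace = (Jᴴ * J * (B * Aᴴ)).trace := by
    intro J A B
    rw [Matrix.conjTranspose_mul, ← Matrix.mul_assoc (Jᴴ * J), Matrix.trace_mul_comm _ Aᴴ]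
    simp only [Matrix.mul_assoc]
  have n1 := trace_mul_re_nonneg hT (self_mul_conjTranspose_nonneg X)
  have n2 := trace_mul_re_nonneg hT (self_mul_conjTranspose_nonneg Y)
  have n3 := trace_mul_re_nonneg (sub_nonneg.2 hT1) (self_mul_conjTranspose_nonneg X)
  have n4 := trace_mul_re_nonneg (sub_nonneg.2 hT1) (self_mul_conjTranspose_nonneg Y)
  rw [e, e, e, hL] at cs1
  rw [e, e, e, hK] at cs2
  have hs : (Xᴴ * Y).trace.re = (T * (Y * Xᴴ)).trace.re + ((1 - T) * (Y * Xᴴ)).trace.re := by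
    rw [← Complex.add_re, ← Matrix.trace_add, ← Matrix.add_mul, add_sub_cancel, Matrix.one_mul,
      Matrix.trace_mul_comm]
  have s1 : (T * (X * Xᴴ)).trace.re + ((1 - T) * (X * Xᴴ)).trace.re ≤ 1 := by
    rwa [← Complex.add_re, ← Matrix.trace_add, ← Matrix.add_mul, add_sub_cancel, Matrix.one_mul]
  have s2 : (T * (Y * Yᴴ)).trace.re + ((1 - T) * (Y * Yᴴ)).trace.re ≤ 1 := by
    rwa [← Complex.add_re, ← Matrix.trace_add, ← Matrix.add_mul, add_sub_cancel, Matrix.one_mul]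
  rw [hs]
  generalize (T * (X * Xᴴ)).trace.re = p at *
  generalize (T * (Y * Yᴴ)).trace.re = r at *
  generalize ((1 - T) * (X * Xᴴ)).trace.re = p' at *
  generalize ((1 - T) * (Y * Yᴴ)).trace.re = r' at *
  generalize (T * (Y * Xᴴ)).trace.re = a at *
  generalize ((1 - T) * (Y * Xᴴ)).trace.re = b at *
  have hab : 2 * (a * b) ≤ p * p' + r * r' := by
    refine abs_le_of_sq_le_sq' ?_ (by positivity) |>.2
    have : (a * b) ^ 2 ≤ (p * r) * (p' * r') := by
      rw [mul_pow]; exact mul_le_mul cs1 cs2 (sq_nonneg _) (by positivity)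
    nlinarith [sq_nonneg (p * p' - r * r')]
  have h1 : p * (p + p') ≤ p * 1 := mul_le_mul_of_nonneg_left s1 n1
  have h2 : r * (r + r') ≤ r * 1 := mul_le_mul_of_nonneg_left s2 n2
  have h3 : p' * r' ≤ (1 - p) * (1 - r) :=
    mul_le_mul (by linarith) (by linarith) n4 (by linarith)
  nlinarith

/-- Gentle measurement: a contraction `K` that nearly preserves the amplitude of the state `X Xᴴ`
changes the success probability of a test only a little. -/
theorem gentle_contraction {T : Matrix n n ℂ} (hT : 0 ≤ T) (hT1 : T ≤ 1)
    {ω : Matrix n n ℂ} (hω : 0 ≤ ω) (hω1 : ω.trace.re = 1) {K : Matrix n n ℂ} (hK : Kᴴ * K ≤ 1)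
    {d : ℝ} (hd : d ≤ 1) (hKω : 1 - d ≤ (K * ω).trace.re) :
    (T * ω).trace.re - √(2 * d) ≤ (Kᴴ * T * K * ω).trace.re := by
  set X := CFC.sqrt ω
  have hX : X * Xᴴ = ω := by rw [sqrt_conjTranspose, sqrt_mul_sqrt hω]
  have h1 : (K * X * (K * X)ᴴ).trace.re ≤ 1 := by
    rw [Matrix.conjTranspose_mul, Matrix.mul_assoc, ← Matrix.mul_assoc X, hX, ← Matrix.mul_assoc,
      Matrix.trace_mul_comm, ← Matrix.mul_assoc, ← hω1]
    simpa using trace_mul_re_mono_left hK hω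
  have h := overlap_sq_add_test_sq_le hT hT1 (X := X) (Y := K * X) (by rw [hX, hω1]) h1
  have e1 : (Xᴴ * (K * X)).trace.re = (K * ω).trace.re := by
    rw [Matrix.trace_mul_comm, Matrix.mul_assoc, hX]
  have e2 : (T * (K * X * (K * X)ᴴ)).trace.re = (Kᴴ * T * K * ω).trace.re := by
    rw [Matrix.conjTranspose_mul, Matrix.mul_assoc K, ← Matrix.mul_assoc X, hX,
      ← Matrix.mul_assoc K, ← Matrix.mul_assoc T, Matrix.trace_mul_comm]
    simp only [Matrix.mul_assoc]
  rw [e1, e2, hX] at h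
  have : (T * ω).trace.re - (Kᴴ * T * K * ω).trace.re ≤ √(2 * d) := by
    apply Real.le_sqrt_of_sq_le
    nlinarith [mul_self_le_mul_self (by linarith : 0 ≤ 1 - d) hKω]
  linarith

/-- The contraction `U` comes from the polar decomposition; the functional calculus of
`x ↦ (√x)⁻¹` is a pseudo-inverse, as `(√0)⁻¹ = 0`. -/
theorem exists_contraction_trace_mul_eq_traceNorm (M : Matrix n n ℂ) :
    ∃ U : Matrix n n ℂ, U * Uᴴ ≤ 1 ∧ (U * M).trace.re = traceNorm M := by
  have hN : 0 ≤ Mᴴ * M := conjTranspose_mul_self_nonneg M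
  set N := Mᴴ * M with hNdef
  have hsa : IsSelfAdjoint N := conjTranspose_eq_of_nonneg hN
  have hc : ∀ f : ℝ → ℝ, ContinuousOn f (spectrum ℝ N) :=
    fun f => (Matrix.finite_real_spectrum).continuousOn f
  have hspec : ∀ x ∈ spectrum ℝ N, 0 ≤ x := fun x hx => spectrum_nonneg_of_nonneg hN hx
  set Q := cfc (fun x : ℝ => (√x)⁻¹) N with hQ
  have hQsa : Qᴴ = Q := (cfc_predicate (fun x : ℝ => (√x)⁻¹) N : IsSelfAdjoint Q)
  have hid : cfc (fun x : ℝ => x) N = N := cfc_id' ℝ N hsa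
  have hQN : Q * N = CFC.sqrt N := by
    have hs : CFC.sqrt N = cfc Real.sqrt N := by
      rw [CFC.sqrt_eq_real_sqrt N hN]; exact cfcₙ_eq_cfc (by fun_prop) (by simp)
    have hm := cfc_mul (fun x : ℝ => (√x)⁻¹) (fun x : ℝ => x) N (hc _) (hc _)
    rw [hid] at hm
    rw [hs, hQ, ← hm]
    refine cfc_congr fun x hx => ?_
    have := hspec x hx
    rcases eq_or_lt_of_le this with h0 | h0
    · simp [← h0]
    · have h1 : √x ≠ 0 := (Real.sqrt_pos.2 h0).ne'
      field_simp
      exact (Real.sq_sqrt this).symm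
  refine ⟨Q * Mᴴ, ?_, ?_⟩
  · have e : Q * Mᴴ * (Q * Mᴴ)ᴴ = CFC.sqrt N * Q := by
      rw [Matrix.conjTranspose_mul, Matrix.conjTranspose_conjTranspose, hQsa, ← hQN, hNdef]
      simp only [Matrix.mul_assoc]
    rw [e]
    have hs : CFC.sqrt N = cfc Real.sqrt N := by
      rw [CFC.sqrt_eq_real_sqrt N hN]; exact cfcₙ_eq_cfc (by fun_prop) (by simp)
    rw [hs, hQ, ← cfc_mul _ _ N (hc _) (hc _)]
    refine cfc_le_one _ _ fun x hx => ?_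
    exact mul_inv_le_one
  · rw [Matrix.mul_assoc, ← hNdef, hQN]; rfl

theorem traceNorm_nonneg (M : Matrix n n ℂ) : 0 ≤ traceNorm M :=
  trace_re_nonneg (CFC.sqrt_nonneg _)

/-- A contraction aligning the canonical purifications of two states, as in Uhlmann's theorem. -/
theorem exists_contraction_fidelity (ρ σ : Matrix n n ℂ) :
    ∃ U : Matrix n n ℂ, U * Uᴴ ≤ 1 ∧
      ((CFC.sqrt ρ)ᴴ * (CFC.sqrt σ * U)).trace.re = fidelity ρ σ := by
  obtain ⟨U, hU, h⟩ := exists_contraction_trace_mul_eq_traceNorm (CFC.sqrt ρ * CFC.sqrt σ)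
  refine ⟨U, hU, ?_⟩
  rw [fidelity, ← h, sqrt_conjTranspose, ← Matrix.mul_assoc, Matrix.trace_mul_comm]

theorem sqrt_mul_contraction_le {σ U : Matrix n n ℂ} (hσ : 0 ≤ σ) (hU : U * Uᴴ ≤ 1) :
    CFC.sqrt σ * U * (CFC.sqrt σ * U)ᴴ ≤ σ := by
  have := mul_mul_conjTranspose_mono hU (CFC.sqrt σ)
  rw [Matrix.mul_one, sqrt_conjTranspose, sqrt_mul_sqrt hσ] at this
  rw [Matrix.conjTranspose_mul, sqrt_conjTranspose]
  simpa only [Matrix.mul_assoc] using this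

theorem IsState.nonneg {ρ : Matrix n n ℂ} (h : IsState ρ) : 0 ≤ ρ :=
  Matrix.nonneg_iff_posSemidef.2 h.posSemidef

theorem IsState.trace_re {ρ : Matrix n n ℂ} (h : IsState ρ) : ρ.trace.re = 1 := by
  rw [h.trace_eq_one]; rfl

theorem test_sub_test_le_purifiedDistance {ρ σ T : Matrix n n ℂ} (hρ : IsState ρ) (hσ : IsState σ)
    (hT : 0 ≤ T) (hT1 : T ≤ 1) :
    (T * ρ).trace.re - (T * σ).trace.re ≤ purifiedDistance ρ σ := by
  obtain ⟨U, hU, hF⟩ := exists_contraction_fidelity ρ σ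
  have hY := sqrt_mul_contraction_le hσ.nonneg hU
  have hX : CFC.sqrt ρ * (CFC.sqrt ρ)ᴴ = ρ := by rw [sqrt_conjTranspose, sqrt_mul_sqrt hρ.nonneg]
  have h := overlap_sq_add_test_sq_le hT hT1 (X := CFC.sqrt ρ) (Y := CFC.sqrt σ * U)
    (by rw [hX, hρ.trace_re]) ((trace_re_mono hY).trans_eq hσ.trace_re)
  rw [hF, hX] at h
  have h2 := trace_mul_re_mono_right hT hY
  have : (T * ρ).trace.re - (T * (CFC.sqrt σ * U * (CFC.sqrt σ * U)ᴴ)).trace.re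
      ≤ purifiedDistance ρ σ := Real.le_sqrt_of_sq_le (by linarith)
  linarith

/-- The other half of the bound of the trace distance by the purified distance. It is obtained from
the complementary test, without the symmetry of the fidelity. -/
theorem test_sub_test_le_purifiedDistance' {ρ σ T : Matrix n n ℂ} (hρ : IsState ρ)
    (hσ : IsState σ) (hT : 0 ≤ T) (hT1 : T ≤ 1) :
    (T * σ).trace.re - (T * ρ).trace.re ≤ purifiedDistance ρ σ := by
  have := test_sub_test_le_purifiedDistance hρ hσ (sub_nonneg.2 hT1)
    (sub_le_self 1 hT)
  simp only [Matrix.sub_mul, Matrix.one_mul, Matrix.trace_sub, Complex.sub_re, hρ.trace_re,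
    hσ.trace_re] at this
  linarith

/-- Closeness in fidelity, turned into an operator inequality with a small additive error. The
error is `D Dᴴ`, where `D` is the difference of optimally aligned purifications. -/
theorem exists_le_four_smul_add {ρ σ : Matrix n n ℂ} (hρ : IsState ρ) (hσ : IsState σ) :
    ∃ Δ : Matrix n n ℂ, 0 ≤ Δ ∧ ρ ≤ ((4 : ℝ) : ℂ) • σ + Δ ∧
      Δ.trace.re ≤ 4 / 3 * (2 - 2 * fidelity ρ σ) := by
  obtain ⟨U, hU, hF⟩ := exists_contraction_fidelity ρ σ
  have hY := sqrt_mul_contraction_le hσ.nonneg hU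
  have hX : CFC.sqrt ρ * (CFC.sqrt ρ)ᴴ = ρ := by rw [sqrt_conjTranspose, sqrt_mul_sqrt hρ.nonneg]
  set A := CFC.sqrt ρ
  set B := CFC.sqrt σ * U
  refine ⟨((4 / 3 : ℝ) : ℂ) • ((A - B) * (A - B)ᴴ),
    smul_matrix_nonneg (self_mul_conjTranspose_nonneg _) (by norm_num), ?_, ?_⟩
  · have h4 : ρ ≤ ((4 : ℝ) : ℂ) • (B * Bᴴ) + ((4 / 3 : ℝ) : ℂ) • ((A - B) * (A - B)ᴴ) := by
      -- The difference of the two sides is `(A - 4B)(A - 4B)ᴴ / 3`.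
      have := smul_matrix_nonneg (self_mul_conjTranspose_nonneg (A - (4 : ℂ) • B))
        (c := 1 / 3) (by norm_num)
      rw [← sub_nonneg, ← hX]
      convert this using 1
      simp only [Matrix.conjTranspose_sub, Matrix.conjTranspose_smul, Matrix.sub_mul,
        Matrix.mul_sub, Matrix.smul_mul, Matrix.mul_smul]
      push_cast
      have : star (4 : ℂ) = 4 := by simp
      rw [this]
      module
    refine h4.trans ?_
    exact add_le_add_left (smul_le_smul_matrix hY (by norm_num)) _
  · rw [Matrix.trace_smul, smul_eq_mul, Complex.re_ofReal_mul]
    refine mul_le_mul_of_nonneg_left ?_ (by norm_num)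
    have e1 : (A * Bᴴ).trace.re = fidelity ρ σ := by
      rw [← hF, ← trace_conjTranspose_re, Matrix.conjTranspose_mul,
        Matrix.conjTranspose_conjTranspose, Matrix.trace_mul_comm]
    have e2 : (B * Aᴴ).trace.re = fidelity ρ σ := by
      rw [← hF, Matrix.trace_mul_comm]
    have := (trace_re_mono hY).trans_eq hσ.trace_re
    simp only [Matrix.conjTranspose_sub, Matrix.sub_mul, Matrix.mul_sub, Matrix.trace_sub,
      Complex.sub_re, e1, e2, hX, hρ.trace_re]
    linarith

/-- The inverse square root of an operator `K ≥ κ > 0`, with its defining properties. -/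
theorem exists_inv_sqrt {K : Matrix n n ℂ} {κ : ℝ} (hκ : 0 < κ)
    (hK : (κ : ℂ) • (1 : Matrix n n ℂ) ≤ K) :
    ∃ L : Matrix n n ℂ, 0 ≤ L ∧ L * CFC.sqrt K = 1 ∧ CFC.sqrt K * L = 1 := by
  have h0 : 0 ≤ K := (smul_matrix_nonneg one_nonneg_matrix hκ.le).trans hK
  have hpd : K.PosDef := by
    have h1 : (((κ : ℂ) • (1 : Matrix n n ℂ))).PosDef :=
      Matrix.PosDef.one.smul (by exact_mod_cast hκ)
    have := h1.add_posSemidef (Matrix.le_iff.1 hK)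
    rwa [add_sub_cancel] at this
  have hdet : IsUnit (CFC.sqrt K).det := by
    have : IsUnit ((CFC.sqrt K * CFC.sqrt K).det) := by
      rw [sqrt_mul_sqrt h0]; exact hpd.det_pos.ne'.isUnit
    rw [Matrix.det_mul] at this
    exact isUnit_of_mul_isUnit_left this
  exact ⟨(CFC.sqrt K)⁻¹, Matrix.nonneg_iff_posSemidef.2
    (Matrix.nonneg_iff_posSemidef.1 (CFC.sqrt_nonneg K)).inv,
    Matrix.nonsing_inv_mul _ hdet, Matrix.mul_nonsing_inv _ hdet⟩

/-- For a contraction `G`, the Hermitian part of `1 - G` is nonnegative. -/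
theorem trace_re_le_of_contraction {G ρ K : Matrix n n ℂ} (hG : Gᴴ * G ≤ 1) (hK : ρ ≤ K) :
    ρ.trace.re - (G * ρ).trace.re ≤ K.trace.re - (G * K).trace.re := by
  have h1 : 0 ≤ (1 - G) + (1 - G)ᴴ := by
    have := conjTranspose_mul_self_nonneg (1 - G)
    have h2 := add_nonneg this (sub_nonneg.2 hG)
    convert h2 using 1
    simp only [Matrix.conjTranspose_sub, Matrix.conjTranspose_one, Matrix.sub_mul, Matrix.mul_sub,
      Matrix.one_mul, Matrix.mul_one]
    abel
  have h3 := trace_mul_re_nonneg h1 (sub_nonneg.2 hK)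
  have h4 : ((1 - G)ᴴ * (K - ρ)).trace.re = ((1 - G) * (K - ρ)).trace.re := by
    rw [← trace_conjTranspose_re, Matrix.conjTranspose_mul,
      conjTranspose_eq_of_nonneg (sub_nonneg.2 hK), Matrix.trace_mul_comm,
      Matrix.conjTranspose_conjTranspose]
  rw [Matrix.add_mul, Matrix.trace_add, Complex.add_re, h4] at h3
  simp only [Matrix.sub_mul, Matrix.mul_sub, Matrix.one_mul, Matrix.trace_sub,
    Complex.sub_re] at h3
  linarith

/-- If `ρ ≤ σ + Δ` with `Δ` small, then a contraction close to the identity on `ρ` moves `ρ`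
below `σ`. The contraction is `√σ (σ + Δ)^{-1/2}`. -/
theorem exists_contraction_of_le_add {ρ σ Δ : Matrix n n ℂ} (hσ : 0 ≤ σ) {κ : ℝ} (hκ : 0 < κ)
    (hΔ : (κ : ℂ) • (1 : Matrix n n ℂ) ≤ Δ) (h : ρ ≤ σ + Δ) :
    ∃ G : Matrix n n ℂ, Gᴴ * G ≤ 1 ∧ G * ρ * Gᴴ ≤ σ ∧
      ρ.trace.re - Δ.trace.re ≤ (G * ρ).trace.re := by
  have hΔ0 : 0 ≤ Δ := (smul_matrix_nonneg one_nonneg_matrix hκ.le).trans hΔ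
  have hKκ : (κ : ℂ) • (1 : Matrix n n ℂ) ≤ σ + Δ := hΔ.trans (le_add_of_nonneg_left hσ)
  have hK0 : 0 ≤ σ + Δ := add_nonneg hσ hΔ0
  obtain ⟨L, hL0, hLQ, hQL⟩ := exists_inv_sqrt hκ hKκ
  have hQ2 := sqrt_mul_sqrt hK0
  have hLs := conjTranspose_eq_of_nonneg hL0
  have hmono : CFC.sqrt σ ≤ CFC.sqrt (σ + Δ) := sqrt_mono (le_add_of_nonneg_right hΔ0)
  set Q := CFC.sqrt (σ + Δ)
  have hLKL : L * (σ + Δ) * L = 1 := by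
    rw [← hQ2, ← Matrix.mul_assoc, hLQ, Matrix.one_mul, hQL]
  set P := CFC.sqrt σ with hP
  have hPP : P * P = σ := sqrt_mul_sqrt hσ
  have hPs : Pᴴ = P := sqrt_conjTranspose σ
  have hG1 : (P * L)ᴴ * (P * L) ≤ 1 := by
    have := mul_mul_conjTranspose_mono (le_add_of_nonneg_right hΔ0 : σ ≤ σ + Δ) L
    rw [hLs, hLKL] at this
    rw [Matrix.conjTranspose_mul, hLs, hPs]
    calc L * P * (P * L) = L * σ * L := by rw [← hPP]; simp only [Matrix.mul_assoc]
      _ ≤ 1 := this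
  refine ⟨P * L, hG1, ?_, ?_⟩
  · have := mul_mul_conjTranspose_mono h (P * L)
    refine this.trans_eq ?_
    rw [Matrix.conjTranspose_mul, hLs, hPs]
    calc P * L * (σ + Δ) * (L * P) = P * (L * (σ + Δ) * L) * P := by simp only [Matrix.mul_assoc]
      _ = σ := by rw [hLKL, Matrix.mul_one, hPP]
  · have h1 := trace_re_le_of_contraction hG1 h
    have h2 : (P * L * (σ + Δ)).trace.re = (P * Q).trace.re := by
      rw [← hQ2, Matrix.mul_assoc, ← Matrix.mul_assoc L, hLQ, Matrix.one_mul]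
    have h3 := trace_mul_re_mono_right (CFC.sqrt_nonneg σ) hmono
    rw [← hP, hPP] at h3
    rw [h2, Matrix.trace_add, Complex.add_re] at h1
    linarith

/-- A smoothed form of Markov's inequality: if `ω` has small expectation in the state `ρ`, then a
contraction close to the identity on `ρ` cuts `ω` down to a small operator. The contraction is
`(1 + ω / c)^{-1/2}`. -/
theorem exists_contraction_mul_mul_le {ω ρ : Matrix n n ℂ} (hω : 0 ≤ ω) (hρ : 0 ≤ ρ)
    {c : ℝ} (hc : 0 < c) :
    ∃ S : Matrix n n ℂ, Sᴴ * S ≤ 1 ∧ Sᴴ * ω * S ≤ (c : ℂ) • 1 ∧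
      ρ.trace.re - (ω * ρ).trace.re / (2 * c) ≤ (S * ρ).trace.re := by
  set K : Matrix n n ℂ := 1 + ((c⁻¹ : ℝ) : ℂ) • ω with hKdef
  have hω' : 0 ≤ ((c⁻¹ : ℝ) : ℂ) • ω := smul_matrix_nonneg hω (by positivity)
  have hK1 : 1 ≤ K := le_add_of_nonneg_right hω'
  have hK0 : 0 ≤ K := one_nonneg_matrix.trans hK1
  obtain ⟨L, hL0, hLQ, hQL⟩ := exists_inv_sqrt (κ := 1) one_pos (K := K) (by simpa using hK1)
  have hQ2 := sqrt_mul_sqrt hK0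
  have hLs := conjTranspose_eq_of_nonneg hL0
  set Q := CFC.sqrt K
  have hQs : Qᴴ = Q := sqrt_conjTranspose K
  have hLKL : L * K * L = 1 := by
    rw [← hQ2, ← Matrix.mul_assoc, hLQ, Matrix.one_mul, hQL]
  have hLL : L * L ≤ 1 := by
    have := mul_mul_conjTranspose_mono hK1 L
    rwa [hLs, hLKL, Matrix.mul_one] at this
  have hωK : ω = (c : ℂ) • (K - 1) := by
    rw [hKdef, add_sub_cancel_left, smul_smul, ← Complex.ofReal_mul, mul_inv_cancel₀ hc.ne']
    simp
  refine ⟨L, by rwa [hLs], ?_, ?_⟩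
  · rw [hLs, hωK, Matrix.mul_smul, Matrix.smul_mul]
    refine smul_le_smul_matrix ?_ hc.le
    rw [Matrix.mul_sub, Matrix.sub_mul, hLKL, Matrix.mul_one]
    refine sub_le_self _ ?_
    simpa [hLs] using conjTranspose_mul_self_nonneg L
  · -- `K - 1 - 2 (1 - L) = (Q - 1) (1 + 2 L) (Q - 1)`, as `K = Q²` and `L = Q⁻¹`.
    have h1 : 0 ≤ (Q - 1) * (1 + (L + L)) * (Q - 1) := by
      have := mul_mul_conjTranspose_mono
        (add_nonneg one_nonneg_matrix (add_nonneg hL0 hL0) : 0 ≤ 1 + (L + L)) (Q - 1)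
      simpa [hQs] using this
    have h2 : (Q - 1) * (1 + (L + L)) * (Q - 1) = K - 1 - (1 - L) - (1 - L) := by
      simp only [Matrix.sub_mul, Matrix.mul_sub, Matrix.add_mul, Matrix.mul_add, Matrix.one_mul,
        Matrix.mul_one, hQL, hLQ, hQ2]
      abel
    rw [h2] at h1
    have h3 := trace_mul_re_nonneg h1 hρ
    have h4 : (ω * ρ).trace.re = c * ((K - 1) * ρ).trace.re := by
      rw [hωK, Matrix.smul_mul, Matrix.trace_smul, smul_eq_mul, Complex.re_ofReal_mul]
    rw [h4, mul_comm 2 c, mul_div_mul_left _ _ hc.ne']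
    simp only [Matrix.sub_mul, Matrix.one_mul, Matrix.trace_sub, Complex.sub_re] at h3 ⊢
    linarith

/-- The operator form of `(x + y)² ≤ (1 + c⁻¹) x² + (1 + c) y²`. -/
theorem one_add_mul_mul_one_add_le {T J : Matrix n n ℂ} (hT : 0 ≤ T) (hJ : Jᴴ = J) {c : ℝ}
    (hc : 0 < c) :
    (1 + J) * T * (1 + J) ≤ ((1 + c⁻¹ : ℝ) : ℂ) • T + ((1 + c : ℝ) : ℂ) • (J * T * J) := by
  have hcc : ((c⁻¹ : ℝ) : ℂ) * (c : ℂ) = 1 := by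
    rw [← Complex.ofReal_mul, inv_mul_cancel₀ hc.ne', Complex.ofReal_one]
  have hst : star (c : ℂ) = c := Complex.conj_ofReal c
  have a := mul_mul_conjTranspose_mono hT (1 - (c : ℂ) • J)
  have b := smul_le_smul_matrix a (c := c⁻¹) (by positivity)
  have e : ((c⁻¹ : ℝ) : ℂ) • ((1 - (c : ℂ) • J) * T * (1 - (c : ℂ) • J)ᴴ)
      = ((c⁻¹ : ℝ) : ℂ) • T - J * T - T * J + (c : ℂ) • (J * T * J) := by
    rw [Matrix.conjTranspose_sub, Matrix.conjTranspose_smul, Matrix.conjTranspose_one, hst, hJ]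
    simp only [Matrix.sub_mul, Matrix.mul_sub, Matrix.smul_mul, Matrix.mul_smul, Matrix.one_mul,
      Matrix.mul_one, smul_sub, smul_smul, hcc]
    have hc2 : ((c⁻¹ : ℝ) : ℂ) * ((c : ℂ) * (c : ℂ)) = c := by rw [← mul_assoc, hcc, one_mul]
    rw [hc2]
    module
  rw [e, Matrix.mul_zero, Matrix.zero_mul, smul_zero] at b
  rw [← sub_nonneg]
  refine b.trans_eq ?_
  have e' : (1 + J) * T * (1 + J) = T + J * T + T * J + J * T * J := by
    simp only [Matrix.add_mul, Matrix.mul_add, Matrix.one_mul, Matrix.mul_one]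
    abel
  rw [e']
  push_cast
  module

/-- The Hayashi–Nagaoka inequality, with `S + T ≥ κ > 0` so that the inverse square root `L` of
`S + T` exists. -/
theorem one_sub_inv_sqrt_mul_mul_le {S T L : Matrix n n ℂ} (hS : 0 ≤ S) (hS1 : S ≤ 1) (hT : 0 ≤ T)
    (hL0 : 0 ≤ L) (hLQ : L * CFC.sqrt (S + T) = 1) (hQL : CFC.sqrt (S + T) * L = 1) {c : ℝ}
    (hc : 0 < c) :
    1 - L * S * L ≤ ((1 + c : ℝ) : ℂ) • (1 - S) + ((2 + c + c⁻¹ : ℝ) : ℂ) • T := by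
  have hLs := conjTranspose_eq_of_nonneg hL0
  have hK0 := add_nonneg hS hT
  have hQ2 := sqrt_mul_sqrt hK0
  have hSQ : S ≤ CFC.sqrt (S + T) := by
    have h2 : S * S ≤ S := by
      have a := mul_mul_conjTranspose_mono (sub_nonneg.2 hS1) S
      have b := mul_mul_conjTranspose_mono hS (1 - S)
      rw [conjTranspose_eq_of_nonneg hS] at a
      rw [conjTranspose_eq_of_nonneg (sub_nonneg.2 hS1)] at b
      rw [Matrix.mul_zero, Matrix.zero_mul] at a b
      rw [← sub_nonneg]
      refine (add_nonneg a b).trans_eq ?_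
      simp only [Matrix.sub_mul, Matrix.mul_sub, Matrix.one_mul, Matrix.mul_one, Matrix.mul_assoc]
      abel
    have h3 := sqrt_mono (h2.trans (le_add_of_nonneg_right hT))
    rwa [CFC.sqrt_mul_self S hS] at h3
  set Q := CFC.sqrt (S + T)
  have hLKL : L * (S + T) * L = 1 := by
    rw [← hQ2, ← Matrix.mul_assoc, hLQ, Matrix.one_mul, hQL]
  have e1 : 1 - L * S * L = L * T * L := by
    rw [← hLKL, Matrix.mul_add, Matrix.add_mul, add_sub_cancel_left]
  -- `L T L` is split at `L = 1 + (L - 1)`.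
  have e2 : L * T * L ≤ ((1 + c⁻¹ : ℝ) : ℂ) • T
      + ((1 + c : ℝ) : ℂ) • ((L - 1) * T * (L - 1)) := by
    have := one_add_mul_mul_one_add_le hT (J := L - 1) (by simp [hLs]) hc
    rwa [add_sub_cancel] at this
  have e3 : (L - 1) * T * (L - 1) ≤ 1 - S + T := by
    have a := mul_mul_conjTranspose_mono (le_add_of_nonneg_left hS : T ≤ S + T) (L - 1)
    have hL1 : (L - 1)ᴴ = L - 1 := by simp [hLs]
    rw [hL1] at a
    refine a.trans ?_
    have b : (L - 1) * (S + T) * (L - 1) = 1 - Q - Q + (S + T) := by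
      have hKL : (S + T) * L = Q := by rw [← hQ2, Matrix.mul_assoc, hQL, Matrix.mul_one]
      have hLK : L * (S + T) = Q := by rw [← hQ2, ← Matrix.mul_assoc, hLQ, Matrix.one_mul]
      rw [Matrix.sub_mul, hLK, Matrix.one_mul, Matrix.sub_mul, Matrix.mul_sub, Matrix.mul_sub, hQL,
        hKL, Matrix.mul_one, Matrix.mul_one]
      abel
    rw [b, ← sub_nonneg]
    have c := add_nonneg (sub_nonneg.2 hSQ) (sub_nonneg.2 hSQ)
    convert c using 1
    abel
  rw [e1]
  refine e2.trans ?_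
  have e4 := smul_le_smul_matrix e3 (c := 1 + c) (by positivity)
  calc _ ≤ ((1 + c⁻¹ : ℝ) : ℂ) • T + ((1 + c : ℝ) : ℂ) • (1 - S + T) := by gcongr
    _ = _ := by push_cast; module

end MatrixInequalities

/-! ### Partial traces -/

section Marginal

variable {X K D : Type*} [Fintype D]

theorem marginal_apply (glue : K → D → X) (ρ : Matrix X X ℂ) (k k' : K) :
    marginal glue ρ k k' = ∑ d, ρ (glue k d) (glue k' d) := rfl

theorem marginal_nonneg (glue : K → D → X) {ρ : Matrix X X ℂ} (hρ : 0 ≤ ρ) :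
    0 ≤ marginal glue ρ := by
  have h : marginal glue ρ
      = ∑ d, ρ.submatrix (fun k => glue k d) (fun k => glue k d) := by
    ext k k'
    simp [marginal_apply, Matrix.sum_apply]
  rw [h]
  exact Finset.sum_nonneg fun d _ => Matrix.nonneg_iff_posSemidef.2
    ((Matrix.nonneg_iff_posSemidef.1 hρ).submatrix _)

theorem submatrix_nonneg {Y : Type*} (e : Y → X) {ρ : Matrix X X ℂ} (hρ : 0 ≤ ρ) :
    0 ≤ ρ.submatrix e e :=
  Matrix.nonneg_iff_posSemidef.2 ((Matrix.nonneg_iff_posSemidef.1 hρ).submatrix _)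

theorem trace_submatrix_equiv {Y : Type*} [Fintype X] [Fintype Y] (e : Y ≃ X)
    (ρ : Matrix X X ℂ) : (ρ.submatrix e e).trace = ρ.trace :=
  Equiv.sum_comp e fun x => ρ x x

variable [Fintype X] [Fintype K]

theorem trace_marginal (e : K × D ≃ X) (ρ : Matrix X X ℂ) :
    (marginal (fun k d => e (k, d)) ρ).trace = ρ.trace := by
  rw [← trace_submatrix_equiv e, Matrix.trace, Matrix.trace, Fintype.sum_prod_type]
  rfl

/-- The partial trace is adjoint to tensoring with the identity. -/
theorem trace_mul_marginal [DecidableEq D] (e : K × D ≃ X) (T : Matrix K K ℂ)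
    (ρ : Matrix X X ℂ) :
    (T * marginal (fun k d => e (k, d)) ρ).trace
      = ((T ⊗ₖ (1 : Matrix D D ℂ)).submatrix e.symm e.symm * ρ).trace := by
  have h : (T ⊗ₖ (1 : Matrix D D ℂ)).submatrix e.symm e.symm * ρ
      = ((T ⊗ₖ (1 : Matrix D D ℂ)) * ρ.submatrix e e).submatrix e.symm e.symm := by
    rw [← Matrix.submatrix_mul_equiv _ _ _ e.symm]
    simp
  rw [h, trace_submatrix_equiv e.symm]
  simp only [Matrix.trace, Matrix.diag_apply, Matrix.mul_apply, Fintype.sum_prod_type,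
    Matrix.kroneckerMap_apply, Matrix.submatrix_apply, marginal_apply, Matrix.one_apply,
    Finset.mul_sum, mul_ite, ite_mul, mul_one, mul_zero, zero_mul, Finset.sum_ite_eq,
    Finset.mem_univ, if_true]
  exact Finset.sum_congr rfl fun k _ => Finset.sum_comm

end Marginal

/-! ### Measurements as quantum maps -/

section Measurement

set_option linter.unusedSectionVars false

variable {X O : Type*} [Fintype X] [Fintype O] [DecidableEq O]

/-- The quantum-classical map that measures with operators `Λ o` and records the outcome in a basis
state. -/
def measurement (Λ : O → Matrix X X ℂ) : Matrix X X ℂ →ₗ[ℂ] Matrix O O ℂ where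
  toFun M := Matrix.diagonal fun o => (Λ o * M).trace
  map_add' M M' := by
    simp [Matrix.mul_add, Matrix.trace_add]
  map_smul' c M := by
    ext i j
    rcases eq_or_ne i j with rfl | h <;> simp [*]

theorem measurement_apply (Λ : O → Matrix X X ℂ) (M : Matrix X X ℂ) :
    measurement Λ M = Matrix.diagonal fun o => (Λ o * M).trace := rfl

theorem measurement_isQuantumMap [DecidableEq X] {Λ : O → Matrix X X ℂ} (h0 : ∀ o, 0 ≤ Λ o)
    (h1 : ∑ o, Λ o = 1) : IsQuantumMap (measurement Λ) := by
  constructor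
  · intro k M hM
    have hM0 := Matrix.nonneg_iff_posSemidef.2 hM
    rw [← Matrix.nonneg_iff_posSemidef]
    -- `B o` is the unnormalised state of the reference system after the outcome `o`.
    let B : O → Matrix (Fin k) (Fin k) ℂ := fun o =>
      marginal Prod.mk (((1 : Matrix (Fin k) (Fin k) ℂ) ⊗ₖ CFC.sqrt (Λ o)) * M
        * ((1 : Matrix (Fin k) (Fin k) ℂ) ⊗ₖ CFC.sqrt (Λ o))ᴴ)
    have hB : ∀ o, 0 ≤ B o := fun o => marginal_nonneg _ (by
      simpa using mul_mul_conjTranspose_mono hM0 ((1 : Matrix (Fin k) (Fin k) ℂ) ⊗ₖ CFC.sqrt (Λ o)))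
    have hBe : ∀ o i j, B o i j = (Λ o * Matrix.of fun x x' => M (i, x) (j, x')).trace := by
      intro o i j
      have hL : (CFC.sqrt (Λ o))ᴴ = CFC.sqrt (Λ o) := sqrt_conjTranspose _
      have e : B o i j = (CFC.sqrt (Λ o) * (Matrix.of fun x x' => M (i, x) (j, x'))
          * (CFC.sqrt (Λ o))ᴴ).trace := by
        simp only [B, marginal_apply, Matrix.trace, Matrix.diag_apply]
        refine Finset.sum_congr rfl fun y _ => ?_
        simp only [Matrix.mul_apply, Fintype.sum_prod_type, Matrix.one_apply,
          Matrix.kroneckerMap_apply, Matrix.conjTranspose_apply, Matrix.of_apply, ite_mul, one_mul,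
          zero_mul, Finset.sum_ite_irrel, Finset.sum_const_zero, Finset.sum_ite_eq,
          Finset.mem_univ, if_true, apply_ite star, star_zero, mul_ite, mul_zero]
      rw [e, hL, Matrix.mul_assoc, Matrix.trace_mul_comm, Matrix.mul_assoc, sqrt_mul_sqrt (h0 o),
        Matrix.trace_mul_comm]
    have e : blockMap (measurement Λ) k M = ∑ o : O,
        (Matrix.diagonal fun p : Fin k × O => if p.2 = o then (1 : ℂ) else 0)
          * (B o).submatrix Prod.fst Prod.fst
          * (Matrix.diagonal fun p : Fin k × O => if p.2 = o then (1 : ℂ) else 0)ᴴ := by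
      ext p p'
      rw [Matrix.sum_apply]
      simp only [blockMap, Matrix.of_apply, measurement_apply, Matrix.diagonal_conjTranspose,
        Matrix.mul_diagonal, Matrix.diagonal_mul, Matrix.submatrix_apply, hBe]
      rw [Finset.sum_eq_single p.2]
      · by_cases h : p.2 = p'.2
        · simp [h]
        · simp [h, Ne.symm h]
      · intro o _ ho
        simp [ho.symm]
      · simp
    rw [e]
    refine Finset.sum_nonneg fun o _ => ?_
    simpa using mul_mul_conjTranspose_mono (submatrix_nonneg Prod.fst (hB o))
      (Matrix.diagonal fun p : Fin k × O => if p.2 = o then (1 : ℂ) else 0)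
  · intro M
    rw [measurement_apply, Matrix.trace_diagonal, ← Matrix.trace_sum, ← Finset.sum_mul, h1,
      Matrix.one_mul]

end Measurement

/-! ### Position-based decoding -/

section Slots

variable {ι Y H : Type*} [Fintype ι] [DecidableEq ι]

/-- On a system `Y` and one copy of `H` for each slot in `ι`: the operator `X` on `Y` and slot `s`,
and the operator `N` on every other slot. -/
def atSlot (s : ι) (X : Matrix (Y × H) (Y × H) ℂ) (N : Matrix H H ℂ) :
    Matrix (Y × (ι → H)) (Y × (ι → H)) ℂ :=
  Matrix.of fun p p' =>
    ∏ i, if i = s then X (p.1, p.2 i) (p'.1, p'.2 i) else N (p.2 i) (p'.2 i)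

theorem prod_ite_slot (s : ι) (a b : ι → ℂ) :
    (∏ i, if i = s then a i else b i) = a s * ∏ i : {i // i ≠ s}, b i := by
  rw [Fintype.prod_eq_mul_prod_subtype_ne _ s, if_pos rfl]
  congr 1
  exact Finset.prod_congr rfl fun i _ => if_neg i.2

theorem atSlot_apply (s : ι) (X : Matrix (Y × H) (Y × H) ℂ) (N : Matrix H H ℂ)
    (p p' : Y × (ι → H)) :
    atSlot s X N p p'
      = X (p.1, p.2 s) (p'.1, p'.2 s) * ∏ i : {i // i ≠ s}, N (p.2 i) (p'.2 i) :=
  prod_ite_slot s (fun i => X (p.1, p.2 i) (p'.1, p'.2 i)) fun i => N (p.2 i) (p'.2 i)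

theorem atSlot_sub (s : ι) (X X' : Matrix (Y × H) (Y × H) ℂ) (N : Matrix H H ℂ) :
    atSlot s (X - X') N = atSlot s X N - atSlot s X' N := by
  ext p p'
  simp [atSlot_apply, sub_mul]

theorem atSlot_conjTranspose (s : ι) (X : Matrix (Y × H) (Y × H) ℂ) (N : Matrix H H ℂ) :
    (atSlot s X N)ᴴ = atSlot s Xᴴ Nᴴ := by
  ext p p'
  simp [atSlot_apply]

theorem atSlot_one [DecidableEq Y] [DecidableEq H] (s : ι) :
    atSlot s (1 : Matrix (Y × H) (Y × H) ℂ) 1 = 1 := by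
  ext p p'
  rw [atSlot_apply]
  by_cases h : p = p'
  · subst h; simp
  · rw [Matrix.one_apply_ne h]
    by_cases h1 : p.1 = p'.1
    · have h2 : ∃ i, p.2 i ≠ p'.2 i := by
        by_contra! h2
        exact h (Prod.ext h1 (funext h2))
      obtain ⟨i, hi⟩ := h2
      by_cases his : i = s
      · subst his
        rw [Matrix.one_apply_ne (by simp [hi]), zero_mul]
      · have : ∏ i : {i // i ≠ s}, (1 : Matrix H H ℂ) (p.2 i) (p'.2 i) = 0 :=
          Finset.prod_eq_zero (Finset.mem_univ (⟨i, his⟩ : {i // i ≠ s})) (Matrix.one_apply_ne hi)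
        rw [this, mul_zero]
    · rw [Matrix.one_apply_ne (by simp [h1]), zero_mul]

variable [Fintype Y] [Fintype H]

theorem sum_sum_prod_eq_prod_sum_sum {H' : Type*} [Fintype H'] (a : ι → H → H' → ℂ) :
    ∑ f : ι → H, ∑ f' : ι → H', ∏ i, a i (f i) (f' i) = ∏ i, ∑ x, ∑ x', a i x x' := by
  rw [Fintype.prod_sum]
  exact Finset.sum_congr rfl fun f _ => (Fintype.prod_sum fun i x' => a i (f i) x').symm

theorem atSlot_mul (s : ι) (X X' : Matrix (Y × H) (Y × H) ℂ) (N N' : Matrix H H ℂ) :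
    atSlot s X N * atSlot s X' N' = atSlot s (X * X') (N * N') := by
  ext p p'
  rw [Matrix.mul_apply, atSlot_apply, Matrix.mul_apply, Fintype.sum_prod_type,
    Fintype.sum_prod_type, Finset.sum_mul]
  refine Finset.sum_congr rfl fun y _ => ?_
  rw [← prod_ite_slot s (fun i => ∑ h, X (p.1, p.2 i) (y, h) * X' (y, h) (p'.1, p'.2 i))
    (fun i => (N * N') (p.2 i) (p'.2 i))]
  have : ∀ i, (if i = s then ∑ h, X (p.1, p.2 i) (y, h) * X' (y, h) (p'.1, p'.2 i)
      else (N * N') (p.2 i) (p'.2 i))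
      = ∑ h, ((if i = s then X (p.1, p.2 i) (y, h) else N (p.2 i) h)
        * (if i = s then X' (y, h) (p'.1, p'.2 i) else N' h (p'.2 i))) := by
    intro i
    split_ifs <;> simp [Matrix.mul_apply]
  rw [Finset.prod_congr rfl fun i _ => this i, Fintype.prod_sum]
  refine Finset.sum_congr rfl fun f _ => ?_
  rw [Finset.prod_mul_distrib]
  rfl

theorem atSlot_nonneg [DecidableEq Y] [DecidableEq H] (s : ι) {X : Matrix (Y × H) (Y × H) ℂ}
    {N : Matrix H H ℂ} (hX : 0 ≤ X) (hN : 0 ≤ N) : 0 ≤ atSlot s X N := by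
  have := self_mul_conjTranspose_nonneg (atSlot s (CFC.sqrt X) (CFC.sqrt N))
  rwa [atSlot_conjTranspose, atSlot_mul, sqrt_conjTranspose, sqrt_conjTranspose, sqrt_mul_sqrt hX,
    sqrt_mul_sqrt hN] at this

theorem trace_atSlot (s : ι) (X : Matrix (Y × H) (Y × H) ℂ) {N : Matrix H H ℂ}
    (hN : N.trace = 1) : (atSlot s X N).trace = X.trace := by
  rw [Matrix.trace, Matrix.trace, Fintype.sum_prod_type, Fintype.sum_prod_type]
  refine Finset.sum_congr rfl fun y _ => ?_
  simp only [Matrix.diag_apply, atSlot, Matrix.of_apply]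
  rw [← Fintype.prod_sum (fun i h => if i = s then X (y, h) (y, h) else N h h),
    Fintype.prod_eq_single s]
  · simp
  · intro i hi
    simpa [hi, Matrix.trace] using hN

theorem trace_atSlot_mul_atSlot_self [DecidableEq H] (s : ι) (T τ : Matrix (Y × H) (Y × H) ℂ)
    {μ : Matrix H H ℂ} (hμ : μ.trace = 1) :
    (atSlot s T 1 * atSlot s τ μ).trace = (T * τ).trace := by
  rw [atSlot_mul, Matrix.one_mul, trace_atSlot s _ hμ]

/-- A test of `Y` and slot `j`, where `Y` is correlated with another slot `s`, sees `Y` in a product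
state with the content of slot `j`. -/
theorem trace_atSlot_mul_atSlot_of_ne [DecidableEq H] {s j : ι} (hjs : j ≠ s)
    (T τ : Matrix (Y × H) (Y × H) ℂ) {μ : Matrix H H ℂ} (hμ : μ.trace = 1) :
    (atSlot j T 1 * atSlot s τ μ).trace = (T * (marginal Prod.mk τ ⊗ₖ μ)).trace := by
  have hL : (atSlot j T 1 * atSlot s τ μ).trace
      = ∑ y, ∑ y', (∑ h, ∑ h', T (y, h) (y', h') * μ h' h) * (∑ h, τ (y', h) (y, h)) := by
    simp only [Matrix.trace, Matrix.diag_apply, Matrix.mul_apply, Fintype.sum_prod_type]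
    refine Finset.sum_congr rfl fun y _ => ?_
    rw [Finset.sum_comm]
    refine Finset.sum_congr rfl fun y' _ => ?_
    simp only [atSlot, Matrix.of_apply, ← Finset.prod_mul_distrib]
    rw [sum_sum_prod_eq_prod_sum_sum (fun i h h' =>
      (if i = j then T (y, h) (y', h') else (1 : Matrix H H ℂ) h h')
        * (if i = s then τ (y', h') (y, h) else μ h' h)), Fintype.prod_eq_mul j s hjs]
    · congr 1
      · simp [hjs]
      · simp [hjs.symm, Matrix.one_apply]
    · rintro i ⟨hij, his⟩
      simpa [hij, his, Matrix.one_apply, Matrix.trace] using hμ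
  rw [hL]
  simp only [Matrix.trace, Matrix.diag_apply, Matrix.mul_apply, Fintype.sum_prod_type,
    Matrix.kroneckerMap_apply, marginal_apply, Finset.sum_mul]
  refine Finset.sum_congr rfl fun y _ => ?_
  rw [Finset.sum_comm]
  refine Finset.sum_congr rfl fun h _ => Finset.sum_congr rfl fun y' _ =>
    Finset.sum_congr rfl fun h' _ => ?_
  rw [Finset.mul_sum, Finset.mul_sum]
  refine Finset.sum_congr rfl fun x _ => ?_
  ring

/-- Position-based decoding: the pretty good measurement built from one test `T` recognises the slot
with which `Y` is correlated. -/
theorem exists_slot_decoder [DecidableEq Y] [DecidableEq H] {T τ : Matrix (Y × H) (Y × H) ℂ}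
    {μ : Matrix H H ℂ} (hT : 0 ≤ T) (hT1 : T ≤ 1) (hτ : 0 ≤ τ) (hτ1 : τ.trace = 1) (hμ : 0 ≤ μ)
    (hμ1 : μ.trace = 1) {e₁ e₂ c κ : ℝ} (he₁ : 1 - e₁ ≤ (T * τ).trace.re)
    (he₂ : (T * (marginal Prod.mk τ ⊗ₖ μ)).trace.re ≤ e₂) (he₂0 : 0 ≤ e₂) (hc : 0 < c)
    (hκ : 0 < κ) :
    ∃ Λ : ι → Matrix (Y × (ι → H)) (Y × (ι → H)) ℂ, (∀ s, 0 ≤ Λ s) ∧ ∑ s, Λ s ≤ 1 ∧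
      ∀ s, 1 - (Λ s * atSlot s τ μ).trace.re
        ≤ (1 + c) * e₁ + (2 + c + c⁻¹) * (Fintype.card ι * e₂ + κ) := by
  set Γ : ι → Matrix (Y × (ι → H)) (Y × (ι → H)) ℂ := fun s => atSlot s T 1 with hΓ
  have hΓ0 : ∀ s, 0 ≤ Γ s := fun s => atSlot_nonneg s hT one_nonneg_matrix
  have hΓ1 : ∀ s, Γ s ≤ 1 := fun s => by
    rw [← sub_nonneg, ← atSlot_one s, ← atSlot_sub]
    exact atSlot_nonneg s (sub_nonneg.2 hT1) one_nonneg_matrix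
  have hκ1 : (0 : Matrix (Y × (ι → H)) (Y × (ι → H)) ℂ) ≤ (κ : ℂ) • 1 :=
    smul_matrix_nonneg one_nonneg_matrix hκ.le
  have hΓs : 0 ≤ ∑ s, Γ s := Finset.sum_nonneg fun s _ => hΓ0 s
  obtain ⟨K, hK⟩ : ∃ K, K = ∑ s, Γ s + (κ : ℂ) • (1 : Matrix (Y × (ι → H)) (Y × (ι → H)) ℂ) :=
    ⟨_, rfl⟩
  obtain ⟨L, hL0, hLQ, hQL⟩ := exists_inv_sqrt hκ ((le_add_of_nonneg_left hΓs).trans_eq hK.symm)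
  have hLs := conjTranspose_eq_of_nonneg hL0
  have hK0 : 0 ≤ K := (add_nonneg hΓs hκ1).trans_eq hK.symm
  refine ⟨fun s => L * Γ s * L, fun s => ?_, ?_, fun s => ?_⟩
  · simpa [hLs] using mul_mul_conjTranspose_mono (hΓ0 s) L
  · rw [← Finset.sum_mul, ← Finset.mul_sum]
    have := mul_mul_conjTranspose_mono ((le_add_of_nonneg_right hκ1).trans_eq hK.symm) L
    rwa [hLs, ← sqrt_mul_sqrt hK0, ← Matrix.mul_assoc, hLQ, Matrix.one_mul, hQL] at this
  · have hst : 0 ≤ atSlot s τ μ := atSlot_nonneg s hτ hμ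
    have htr : (atSlot s τ μ).trace.re = 1 := by rw [trace_atSlot s τ hμ1, hτ1]; rfl
    set Rest := ∑ j ∈ Finset.univ.erase s, Γ j
      + (κ : ℂ) • (1 : Matrix (Y × (ι → H)) (Y × (ι → H)) ℂ) with hRest
    have hR0 : 0 ≤ Rest := add_nonneg (Finset.sum_nonneg fun j _ => hΓ0 j) hκ1
    have hKs : K = Γ s + Rest := by
      rw [hK, hRest, ← add_assoc, Finset.add_sum_erase _ _ (Finset.mem_univ s)]
    rw [hKs] at hLQ hQL
    have hn := trace_mul_re_mono_left
      (one_sub_inv_sqrt_mul_mul_le (hΓ0 s) (hΓ1 s) hR0 hL0 hLQ hQL hc) hst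
    have h1 : (Γ s * atSlot s τ μ).trace.re = (T * τ).trace.re := by
      rw [hΓ, trace_atSlot_mul_atSlot_self s T τ hμ1]
    have h2 : (Rest * atSlot s τ μ).trace.re ≤ Fintype.card ι * e₂ + κ := by
      rw [hRest, Matrix.add_mul, Matrix.trace_add, Finset.sum_mul, Matrix.trace_sum, Complex.add_re,
        Complex.re_sum, Matrix.smul_mul, Matrix.one_mul, Matrix.trace_smul, smul_eq_mul,
        Complex.re_ofReal_mul, htr, mul_one]
      gcongr
      calc ∑ j ∈ Finset.univ.erase s, (Γ j * atSlot s τ μ).trace.re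
          ≤ ∑ j ∈ Finset.univ.erase s, e₂ := by
            refine Finset.sum_le_sum fun j hj => ?_
            rw [hΓ, trace_atSlot_mul_atSlot_of_ne (Finset.ne_of_mem_erase hj) T τ hμ1]
            exact he₂
        _ ≤ ∑ j : ι, e₂ := Finset.sum_le_sum_of_subset_of_nonneg (Finset.subset_univ _)
            fun _ _ _ => he₂0
        _ = Fintype.card ι * e₂ := by simp
    simp only [Matrix.sub_mul, Matrix.add_mul, Matrix.smul_mul, Matrix.one_mul, Matrix.trace_sub,
      Matrix.trace_add, Matrix.trace_smul, smul_eq_mul, Complex.sub_re, Complex.add_re,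
      Complex.re_ofReal_mul, htr, h1] at hn
    refine hn.trans ?_
    gcongr
    linarith

end Slots

/-! ### Turning one hypothesis test into another -/

section Tests

set_option linter.unusedSectionVars false

variable {D K : Type*} [Fintype D] [Fintype K] [DecidableEq D] [DecidableEq K]

/-- The partial trace over the first system is adjoint to tensoring with the identity. -/
theorem trace_one_kronecker_mul (S : Matrix K K ℂ) (ρ : Matrix (D × K) (D × K) ℂ) :
    (((1 : Matrix D D ℂ) ⊗ₖ S) * ρ).trace = (S * marginal (fun k d => (d, k)) ρ).trace := by
  have h := trace_mul_marginal (Equiv.prodComm K D) S ρ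
  have e : (S ⊗ₖ (1 : Matrix D D ℂ)).submatrix (Equiv.prodComm K D).symm (Equiv.prodComm K D).symm
      = (1 : Matrix D D ℂ) ⊗ₖ S := by
    ext ⟨d, k⟩ ⟨d', k'⟩
    simp [mul_comm]
  rw [e] at h
  exact h.symm

theorem conjTranspose_mul_mul_mem_effects {m : Type*} [Fintype m] [DecidableEq m]
    {T : Matrix K K ℂ} (hT : 0 ≤ T) (hT1 : T ≤ 1) {L : Matrix K m ℂ} (hL : Lᴴ * L ≤ 1) :
    0 ≤ Lᴴ * T * L ∧ Lᴴ * T * L ≤ 1 := by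
  constructor
  · simpa using conjTranspose_mul_mul_mono hT L
  · have := conjTranspose_mul_mul_mono hT1 L
    rw [Matrix.mul_one] at this
    exact this.trans hL

theorem kronecker_one_submatrix_mem_effects {X : Type*} [DecidableEq X] (e : K × D ≃ X)
    {T : Matrix K K ℂ} (hT : 0 ≤ T) (hT1 : T ≤ 1) :
    0 ≤ (T ⊗ₖ (1 : Matrix D D ℂ)).submatrix e.symm e.symm ∧
      (T ⊗ₖ (1 : Matrix D D ℂ)).submatrix e.symm e.symm ≤ 1 := by
  constructor
  · refine submatrix_nonneg _ ?_
    simpa using kronecker_mono_left hT (one_nonneg_matrix (n := D))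
  · have h := submatrix_nonneg e.symm (sub_nonneg.2 (kronecker_mono_left hT1
      (one_nonneg_matrix (n := D))))
    rw [Matrix.submatrix_sub, Matrix.one_kronecker_one] at h
    simpa using h

theorem one_kronecker_contraction {S : Matrix K K ℂ} (hS : Sᴴ * S ≤ 1) :
    ((1 : Matrix D D ℂ) ⊗ₖ S)ᴴ * ((1 : Matrix D D ℂ) ⊗ₖ S) ≤ 1 := by
  rw [Matrix.conjTranspose_kronecker, ← Matrix.mul_kronecker_mul, Matrix.conjTranspose_one,
    Matrix.one_mul, ← Matrix.one_kronecker_one]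
  exact kronecker_mono_right one_nonneg_matrix hS

theorem one_kronecker_mul_kronecker_mul {m : Type*} [Fintype m] (S : Matrix m K ℂ)
    (σ : Matrix K K ℂ) (ρ : Matrix D D ℂ) :
    ((1 : Matrix D D ℂ) ⊗ₖ S) * (ρ ⊗ₖ σ) * ((1 : Matrix D D ℂ) ⊗ₖ S)ᴴ = ρ ⊗ₖ (S * σ * Sᴴ) := by
  rw [Matrix.conjTranspose_kronecker, ← Matrix.mul_kronecker_mul, ← Matrix.mul_kronecker_mul,
    Matrix.conjTranspose_one, Matrix.one_mul, Matrix.mul_one]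

theorem trace_conjTranspose_mul_mul_mul {m : Type*} [Fintype m] (T : Matrix K K ℂ)
    (L : Matrix K m ℂ) (ρ : Matrix m m ℂ) :
    (Lᴴ * T * L * ρ).trace = (T * (L * ρ * Lᴴ)).trace := by
  rw [Matrix.mul_assoc, Matrix.mul_assoc, Matrix.trace_mul_comm]
  simp only [Matrix.mul_assoc]

/-- Pairing the first system of an operator with a fixed state leaves an operator on the second. -/
theorem exists_trace_mul_kronecker_eq {E : Matrix (D × K) (D × K) ℂ} (hE : 0 ≤ E)
    {ρ : Matrix D D ℂ} (hρ : 0 ≤ ρ) :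
    ∃ ω : Matrix K K ℂ, 0 ≤ ω ∧ ∀ σ, (E * (ρ ⊗ₖ σ)).trace = (ω * σ).trace := by
  set J := CFC.sqrt ρ ⊗ₖ (1 : Matrix K K ℂ) with hJ
  have hJs : Jᴴ = J := by
    rw [hJ, Matrix.conjTranspose_kronecker, sqrt_conjTranspose, Matrix.conjTranspose_one]
  refine ⟨marginal (fun k d => (d, k)) (J * E * J), marginal_nonneg _ ?_, fun σ => ?_⟩
  · simpa [hJs] using mul_mul_conjTranspose_mono hE J
  · have e : ρ ⊗ₖ σ = J * ((1 : Matrix D D ℂ) ⊗ₖ σ) * J := by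
      rw [hJ, ← Matrix.mul_kronecker_mul, ← Matrix.mul_kronecker_mul, Matrix.mul_one,
        sqrt_mul_sqrt hρ, Matrix.one_mul, Matrix.mul_one]
    rw [Matrix.trace_mul_comm _ σ, ← trace_one_kronecker_mul, e, ← Matrix.mul_assoc,
      Matrix.trace_mul_comm _ J, Matrix.trace_mul_comm _ (J * E * J)]
    simp only [Matrix.mul_assoc]

/-- A test that separates `ρ` from the product of `ρD` with the marginal of `ρ` can be turned into
one that separates `ρ` from the product of `ρD` with any state: on the second system, the part on
which the test accepts `ρD` too often is suppressed. -/
theorem exists_universal_test {E : Matrix (D × K) (D × K) ℂ} (hE : 0 ≤ E) (hE1 : E ≤ 1)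
    {ρ : Matrix (D × K) (D × K) ℂ} (hρ : 0 ≤ ρ) (hρ1 : ρ.trace.re = 1)
    {ρD : Matrix D D ℂ} (hρD : 0 ≤ ρD) {b δ : ℝ} (hb : 0 < b) (hδ : 0 < δ) (hδ1 : δ ≤ 1)
    (hEb : (E * (ρD ⊗ₖ marginal (fun k d => (d, k)) ρ)).trace.re ≤ b) :
    ∃ T : Matrix (D × K) (D × K) ℂ, 0 ≤ T ∧ T ≤ 1 ∧
      (E * ρ).trace.re - √δ ≤ (T * ρ).trace.re ∧
      ∀ σ, 0 ≤ σ → (T * (ρD ⊗ₖ σ)).trace.re ≤ b / δ * σ.trace.re := by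
  obtain ⟨ω, hω, hωE⟩ := exists_trace_mul_kronecker_eq hE hρD
  set κ := marginal (fun k d => (d, k)) ρ with hκdef
  have hκ : 0 ≤ κ := marginal_nonneg _ hρ
  have hκ1 : κ.trace.re = 1 := by
    rw [← hρ1, hκdef]
    exact congrArg Complex.re (trace_marginal (Equiv.prodComm K D) ρ)
  obtain ⟨S, hS1, hSω, hSκ⟩ := exists_contraction_mul_mul_le hω hκ (div_pos hb hδ)
  have hL := one_kronecker_contraction (D := D) hS1
  set L := (1 : Matrix D D ℂ) ⊗ₖ S with hLdef
  obtain ⟨h0, h1⟩ := conjTranspose_mul_mul_mem_effects hE hE1 hL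
  refine ⟨Lᴴ * E * L, h0, h1, ?_, fun σ hσ => ?_⟩
  · have h2 : 1 - δ / 2 ≤ (L * ρ).trace.re := by
      rw [hLdef, trace_one_kronecker_mul]
      refine le_trans ?_ hSκ
      rw [hκ1]
      have : (ω * κ).trace.re / (2 * (b / δ)) ≤ b / (2 * (b / δ)) := by
        rw [← hωE]; gcongr
      have e : b / (2 * (b / δ)) = δ / 2 := by field_simp
      linarith
    have := gentle_contraction hE hE1 hρ hρ1 hL (by linarith) h2
    rwa [mul_div_cancel₀ _ (two_ne_zero)] at this
  · rw [trace_conjTranspose_mul_mul_mul, hLdef, one_kronecker_mul_kronecker_mul, hωE,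
      ← trace_conjTranspose_mul_mul_mul]
    refine (trace_mul_re_mono_left hSω hσ).trans_eq ?_
    rw [Matrix.smul_mul, Matrix.one_mul, Matrix.trace_smul, smul_eq_mul, Complex.re_ofReal_mul]

/-- As `1 - F² ≤ δ`, the gap `1 - F` is about `δ / 2`; the constant `13 / 25` suffices for
`δ ≤ 1 / 9`. -/
theorem one_sub_le_of_purifiedDistance_le {ρ σ : Matrix K K ℂ} {δ : ℝ} (hδ0 : 0 ≤ δ)
    (hδ : δ ≤ 1 / 9) (h : purifiedDistance ρ σ ≤ √δ) : 1 - fidelity ρ σ ≤ 13 / 25 * δ := by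
  have h1 : 1 - fidelity ρ σ ^ 2 ≤ δ := (Real.sqrt_le_sqrt_iff hδ0).1 h
  have h0 : 0 ≤ fidelity ρ σ := traceNorm_nonneg _
  by_contra! h2
  nlinarith

/-- A test for `τ` against the product of its first marginal with `σ₀` can be turned into one
against the product of its two marginals, if a state near the second marginal lies below a multiple
of `σ₀`. -/
theorem exists_smoothed_test [Nonempty K] {T : Matrix (D × K) (D × K) ℂ} (hT : 0 ≤ T) (hT1 : T ≤ 1)
    {τ : Matrix (D × K) (D × K) ℂ} (hτ : 0 ≤ τ) (hτ1 : τ.trace.re = 1)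
    {ρ ρ' σ₀ : Matrix K K ℂ} (hτρ : marginal (fun k d => (d, k)) τ = ρ) (hρ : IsState ρ)
    (hρ' : IsState ρ') {δ l b : ℝ} (hδ0 : 0 < δ) (hδ : δ ≤ 1 / 9)
    (hd : purifiedDistance ρ ρ' ≤ √δ) (hl : 0 ≤ l) (hσ : ρ' ≤ (l : ℂ) • σ₀)
    (hb : (T * (marginal Prod.mk τ ⊗ₖ σ₀)).trace.re ≤ b) :
    ∃ T' : Matrix (D × K) (D × K) ℂ, 0 ≤ T' ∧ T' ≤ 1 ∧
      (T * τ).trace.re - 2 * √δ ≤ (T' * τ).trace.re ∧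
      (T' * (marginal Prod.mk τ ⊗ₖ ρ)).trace.re ≤ 4 * l * b := by
  obtain ⟨Δ, hΔ0, hΔ, hΔtr⟩ := exists_le_four_smul_add hρ hρ'
  have hF := one_sub_le_of_purifiedDistance_le hδ0.le hδ hd
  have hcard : (0 : ℝ) < Fintype.card K := by exact_mod_cast Fintype.card_pos
  -- `Δ` is made strictly positive, at a cost of `δ / 2` in trace.
  set κ : ℝ := δ / (2 * Fintype.card K) with hκ
  have hκ0 : 0 < κ := by positivity
  have hκ1 : (0 : Matrix K K ℂ) ≤ (κ : ℂ) • 1 := smul_matrix_nonneg one_nonneg_matrix hκ0.le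
  obtain ⟨G, hG1, hGσ, hGρ⟩ := exists_contraction_of_le_add
    (smul_matrix_nonneg hρ'.nonneg (by norm_num : (0 : ℝ) ≤ 4)) hκ0
    (le_add_of_nonneg_left hΔ0 : (κ : ℂ) • 1 ≤ Δ + (κ : ℂ) • 1)
    (hΔ.trans (by rw [← add_assoc]; exact le_add_of_nonneg_right hκ1))
  have htr : (Δ + (κ : ℂ) • (1 : Matrix K K ℂ)).trace.re ≤ 2 * δ := by
    rw [Matrix.trace_add, Matrix.trace_smul, Matrix.trace_one, smul_eq_mul, Complex.add_re,
      Complex.re_ofReal_mul, Complex.natCast_re]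
    have : κ * Fintype.card K = δ / 2 := by rw [hκ]; field_simp
    linarith
  rw [hρ.trace_re] at hGρ
  have hL := one_kronecker_contraction (D := D) hG1
  set L := (1 : Matrix D D ℂ) ⊗ₖ G with hLdef
  obtain ⟨h0, h1⟩ := conjTranspose_mul_mul_mem_effects hT hT1 hL
  refine ⟨Lᴴ * T * L, h0, h1, ?_, ?_⟩
  · have h2 : 1 - 2 * δ ≤ (L * τ).trace.re := by
      rw [hLdef, trace_one_kronecker_mul, hτρ]
      linarith
    have := gentle_contraction hT hT1 hτ hτ1 hL (by linarith) h2
    have e : √(2 * (2 * δ)) = 2 * √δ := by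
      rw [← mul_assoc, Real.sqrt_mul (by norm_num)]
      congr 1
      rw [show (2 : ℝ) * 2 = 2 ^ 2 by norm_num, Real.sqrt_sq (by norm_num)]
    rwa [e] at this
  · have hm : (0 : Matrix D D ℂ) ≤ marginal Prod.mk τ := marginal_nonneg _ hτ
    have h3 : G * ρ * Gᴴ ≤ ((4 * l : ℝ) : ℂ) • σ₀ := by
      refine hGσ.trans ?_
      have := smul_le_smul_matrix hσ (by norm_num : (0 : ℝ) ≤ 4)
      rwa [smul_smul, ← Complex.ofReal_mul] at this
    rw [trace_conjTranspose_mul_mul_mul, hLdef, one_kronecker_mul_kronecker_mul]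
    refine (trace_mul_re_mono_right hT (kronecker_mono_right hm h3)).trans ?_
    rw [Matrix.kronecker_smul, Matrix.mul_smul, Matrix.trace_smul, smul_eq_mul,
      Complex.re_ofReal_mul]
    gcongr

end Tests

/-! ### Operators in Gram form -/

section Gram

variable {X Y Z k : Type*} [Fintype X] [Fintype Z] [DecidableEq Z]

theorem kronecker_one_mul_apply (V : Matrix Y X ℂ) (S : Matrix (X × Z) k ℂ) (y : Y) (z : Z)
    (i : k) : ((V ⊗ₖ (1 : Matrix Z Z ℂ)) * S) (y, z) i = ∑ x, V y x * S (x, z) i := by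
  simp [Matrix.mul_apply, Fintype.sum_prod_type, Matrix.one_apply]

theorem applyLeft_gram [Fintype k] (V : Matrix Y X ℂ) (S : Matrix (X × Z) k ℂ) :
    applyLeft V (S * Sᴴ)
      = ((V ⊗ₖ (1 : Matrix Z Z ℂ)) * S) * ((V ⊗ₖ (1 : Matrix Z Z ℂ)) * S)ᴴ := by
  rw [applyLeft, Matrix.conjTranspose_mul]
  simp only [Matrix.mul_assoc]

theorem applyLeft_gram_apply [Fintype k] (V : Matrix Y X ℂ) (S : Matrix (X × Z) k ℂ)
    (p p' : Y × Z) :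
    applyLeft V (S * Sᴴ) p p'
      = ∑ i, (∑ x, V p.1 x * S (x, p.2) i) * star (∑ x, V p'.1 x * S (x, p'.2) i) := by
  rw [applyLeft_gram, Matrix.mul_apply]
  refine Finset.sum_congr rfl fun i _ => ?_
  rw [Matrix.conjTranspose_apply, kronecker_one_mul_apply, kronecker_one_mul_apply]

theorem sum_isometry_mul_star [Fintype Y] [DecidableEq X] {V : Matrix Y X ℂ} (hV : IsIsometry V)
    (s t : X → ℂ) :
    ∑ y, (∑ x, V y x * s x) * star (∑ x, V y x * t x) = ∑ x, s x * star (t x) := by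
  have h : (V *ᵥ s) ⬝ᵥ star (V *ᵥ t) = s ⬝ᵥ star t := by
    rw [dotProduct_comm, Matrix.star_mulVec, ← Matrix.dotProduct_mulVec, Matrix.mulVec_mulVec, hV,
      Matrix.one_mulVec, dotProduct_comm]
  exact h

theorem IsUnitVector.sum_mul_star {θ : X → ℂ} (h : IsUnitVector θ) :
    ∑ x, θ x * star (θ x) = 1 := by
  rw [← h]
  exact Finset.sum_congr rfl fun x _ => mul_comm _ _

/-- A sum over the contents of all slots factorises, with slot `s` treated apart. -/
theorem sum_mul_prod_subtype_ne {ι E : Type*} [Fintype ι] [DecidableEq ι] [Fintype E] (s : ι)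
    (a : E → ℂ) (b : ι → E → ℂ) :
    ∑ g : ι → E, a (g s) * ∏ i : {i // i ≠ s}, b i (g i)
      = (∑ e, a e) * ∏ i : {i // i ≠ s}, ∑ e, b i e := by
  rw [← prod_ite_slot s (fun _ => ∑ e, a e) (fun i => ∑ e, b i e)]
  have h : ∀ i, (if i = s then ∑ e, a e else ∑ e, b i e) = ∑ e, if i = s then a e else b i e := by
    intro i
    split_ifs <;> rfl
  rw [Finset.prod_congr rfl fun i _ => h i, Fintype.prod_sum]
  exact Finset.sum_congr rfl fun g _ =>
    (prod_ite_slot s (fun i => a (g i)) (fun i => b i (g i))).symm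

end Gram

/-! ### Marginals and copies of the canonical purification -/

section Purification

set_option linter.unusedSectionVars false

variable {R A B C : Type u} [Fintype R] [Fintype A] [Fintype B] [Fintype C]

/-- Splits `R A B C` into `R B` and `A C`. -/
def glueRB : (R × B) × (A × C) ≃ R × A × B × C where
  toFun x := (x.1.1, x.2.1, x.1.2, x.2.2)
  invFun x := ((x.1, x.2.2.1), (x.2.1, x.2.2.2))

/-- Splits `R A B C` into `R B C` and `A`. -/
def glueRBC : (R × B × C) × A ≃ R × A × B × C where
  toFun x := (x.1.1, x.2, x.1.2.1, x.1.2.2)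
  invFun x := ((x.1, x.2.2.1, x.2.2.2), x.2.1)

variable {Ψ : Matrix (R × A × B × C) (R × A × B × C) ℂ}

theorem margRB_eq : margRB Ψ = marginal (fun k d => glueRB (k, d)) Ψ := rfl

theorem margRBC_eq : margRBC Ψ = marginal (fun k d => glueRBC (k, d)) Ψ := rfl

theorem margRB_isState (hΨ : IsState Ψ) : IsState (margRB Ψ) :=
  ⟨Matrix.nonneg_iff_posSemidef.1 (marginal_nonneg _ (Matrix.nonneg_iff_posSemidef.2 hΨ.1)),
    (trace_marginal glueRB Ψ).trans hΨ.trace_eq_one⟩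

theorem margRBC_isState (hΨ : IsState Ψ) : IsState (margRBC Ψ) :=
  ⟨Matrix.nonneg_iff_posSemidef.1 (marginal_nonneg _ (Matrix.nonneg_iff_posSemidef.2 hΨ.1)),
    (trace_marginal glueRBC Ψ).trans hΨ.trace_eq_one⟩

theorem margBC_eq_marginal_margRBC :
    marginal (fun (k : B × C) (d : R) => (d, k)) (margRBC Ψ) = margBC Ψ := by
  ext x x'
  simp only [margBC, margRBC, marginal_apply, Fintype.sum_prod_type]

theorem trace_margB_eq_trace_margRB : (margB Ψ).trace = (margRB Ψ).trace := by
  rw [margRB_eq, trace_marginal]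
  exact trace_marginal (⟨fun x => (x.2.1, x.2.2.1, x.1, x.2.2.2),
    fun x => (x.2.2.1, x.1, x.2.1, x.2.2.2), fun _ => rfl, fun _ => rfl⟩ :
      B × (R × A × C) ≃ R × A × B × C) Ψ

variable [DecidableEq R] [DecidableEq A] [DecidableEq B] [DecidableEq C]

/-- Amplitudes of the canonical purification of `Ψ`, with the label of `AC` first, then that of the
purifying register, then that of `RB`. -/
noncomputable def amp (Ψ : Matrix (R × A × B × C) (R × A × B × C) ℂ) (x : A × C)
    (e : R × A × B × C) (h : R × B) : ℂ :=
  CFC.sqrt Ψ (h.1, x.1, h.2, x.2) e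

theorem sum_amp_mul_star (hΨ : IsState Ψ) (x x' : A × C) (h h' : R × B) :
    ∑ e, amp Ψ x e h * star (amp Ψ x' e h')
      = Ψ (h.1, x.1, h.2, x.2) (h'.1, x'.1, h'.2, x'.2) := by
  have e : CFC.sqrt Ψ * (CFC.sqrt Ψ)ᴴ = Ψ := by
    rw [sqrt_conjTranspose, sqrt_mul_sqrt hΨ.nonneg]
  conv_rhs => rw [← e]
  rfl

theorem sum_amp_margRB (hΨ : IsState Ψ) (h h' : R × B) :
    ∑ e, ∑ x, amp Ψ x e h * star (amp Ψ x e h') = margRB Ψ h h' := by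
  rw [Finset.sum_comm]
  exact Finset.sum_congr rfl fun x _ => sum_amp_mul_star hΨ x x h h'

theorem sum_amp_margAC (hΨ : IsState Ψ) (x x' : A × C) :
    ∑ e, ∑ h, amp Ψ x e h * star (amp Ψ x' e h) = margAC Ψ x x' := by
  rw [Finset.sum_comm]
  exact Finset.sum_congr rfl fun h _ => sum_amp_mul_star hΨ x x' h h

theorem sum_amp (hΨ : IsState Ψ) :
    ∑ e, ∑ h, ∑ x, amp Ψ x e h * star (amp Ψ x e h) = 1 := by
  rw [Finset.sum_comm, ← (margRB_isState hΨ).trace_eq_one]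
  exact Finset.sum_congr rfl fun h _ => sum_amp_margRB hΨ h h

variable {ι : Type} [Fintype ι] [DecidableEq ι]

/-- One copy of the canonical purification of `Ψ` for each slot: Alice holds all `AC` and all
purifying registers, Bob holds all `RB`. -/
noncomputable def copies (ι : Type) [Fintype ι] (Ψ : Matrix (R × A × B × C) (R × A × B × C) ℂ) :
    ((ι → A × C) × (ι → R × A × B × C)) × (ι → R × B) → ℂ :=
  fun p => ∏ i, amp Ψ (p.1.1 i) (p.1.2 i) (p.2 i)

theorem copies_isUnitVector (hΨ : IsState Ψ) : IsUnitVector (copies ι Ψ) := by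
  have h : ∀ p, star (copies ι Ψ) p * copies ι Ψ p
      = ∏ i, amp Ψ (p.1.1 i) (p.1.2 i) (p.2 i) * star (amp Ψ (p.1.1 i) (p.1.2 i) (p.2 i)) := by
    intro p
    rw [Finset.prod_mul_distrib, mul_comm, Pi.star_apply, copies, star_prod]
  rw [IsUnitVector, dotProduct, Finset.sum_congr rfl fun p _ => h p, Fintype.sum_prod_type,
    Fintype.sum_prod_type, Finset.sum_comm]
  have e : ∀ g : ι → R × A × B × C, ∑ x : ι → A × C, ∑ f : ι → R × B,
      ∏ i, amp Ψ (x i) (g i) (f i) * star (amp Ψ (x i) (g i) (f i))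
      = ∏ i, ∑ h, ∑ x, amp Ψ x (g i) h * star (amp Ψ x (g i) h) := by
    intro g
    rw [Finset.sum_comm]
    exact sum_sum_prod_eq_prod_sum_sum fun i h x => amp Ψ x (g i) h * star (amp Ψ x (g i) h)
  rw [Finset.sum_congr rfl fun g _ => e g,
    ← Fintype.prod_sum fun (_ : ι) e => ∑ h, ∑ x, amp Ψ x e h * star (amp Ψ x e h)]
  simp only [sum_amp hΨ, Finset.prod_const_one]

theorem copies_split (s : ι) (x : A × C) (r : {i : ι // i ≠ s} → A × C)
    (g : ι → R × A × B × C) (f : ι → R × B) :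
    copies ι Ψ (((Equiv.funSplitAt s (A × C)).symm (x, r), g), f)
      = amp Ψ x (g s) (f s) * ∏ i : {i // i ≠ s}, amp Ψ (r i) (g i) (f i) := by
  rw [copies, Fintype.prod_eq_mul_prod_subtype_ne _ s]
  congr 1
  · simp
  · refine Finset.prod_congr rfl fun i _ => ?_
    simp [i.2]

theorem sum_copies_split (s : ι) (f f' : ι → R × B) (g : ι → R × A × B × C) :
    ∑ r : {i : ι // i ≠ s} → A × C, (∏ i : {i // i ≠ s}, amp Ψ (r i) (g i) (f i))
        * star (∏ i : {i // i ≠ s}, amp Ψ (r i) (g i) (f' i))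
      = ∏ i : {i // i ≠ s}, ∑ x, amp Ψ x (g i) (f i) * star (amp Ψ x (g i) (f' i)) := by
  rw [Fintype.prod_sum]
  refine Finset.sum_congr rfl fun r _ => ?_
  rw [Finset.prod_mul_distrib, star_prod]

/-- Each pair of registers `AC` of Alice is in the marginal state of `Ψ`. -/
theorem copies_marginal (hΨ : IsState Ψ) (s : ι) :
    marginal
      (fun (x : A × C) (d : (({i : ι // i ≠ s} → A × C) × (ι → R × A × B × C)) × (ι → R × B)) =>
        (((Equiv.funSplitAt s (A × C)).symm (x, d.1.1), d.1.2), d.2))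
      (ketbra (copies ι Ψ)) = margAC Ψ := by
  ext x x'
  simp only [marginal_apply, ketbra, Matrix.vecMulVec_apply, Pi.star_apply, copies_split, star_mul',
    Fintype.sum_prod_type]
  rw [Finset.sum_comm]
  have e : ∀ g : ι → R × A × B × C, ∑ r : {i : ι // i ≠ s} → A × C, ∑ f : ι → R × B,
      (amp Ψ x (g s) (f s) * ∏ i : {i // i ≠ s}, amp Ψ (r i) (g i) (f i))
        * (star (amp Ψ x' (g s) (f s)) * star (∏ i : {i // i ≠ s}, amp Ψ (r i) (g i) (f i)))
      = (∑ h, amp Ψ x (g s) h * star (amp Ψ x' (g s) h))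
        * ∏ i : {i // i ≠ s}, ∑ h, ∑ y, amp Ψ y (g i) h * star (amp Ψ y (g i) h) := by
    intro g
    rw [Finset.sum_comm, ← sum_mul_prod_subtype_ne s
      (fun h => amp Ψ x (g s) h * star (amp Ψ x' (g s) h))
      (fun i h => ∑ y, amp Ψ y (g i) h * star (amp Ψ y (g i) h))]
    refine Finset.sum_congr rfl fun f _ => ?_
    rw [← sum_copies_split s f f g, Finset.mul_sum]
    exact Finset.sum_congr rfl fun r _ => by ring
  rw [Finset.sum_congr rfl fun g _ => e g, sum_mul_prod_subtype_ne s
    (fun e => ∑ h, amp Ψ x e h * star (amp Ψ x' e h))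
    (fun _ e => ∑ h, ∑ y, amp Ψ y e h * star (amp Ψ y e h))]
  simp only [sum_amp hΨ, Finset.prod_const_one, mul_one, sum_amp_margAC hΨ]

end Purification

/-! ### The states of the redistribution protocol -/

section Redistribution

set_option linter.unusedSectionVars false

variable {R A B C EA EB Q TA TB : Type u} [Fintype R] [Fintype A] [Fintype B] [Fintype C]
  [DecidableEq R] [DecidableEq A] [DecidableEq B] [DecidableEq C]
  [Fintype EA] [Fintype EB] [Fintype Q] [Fintype TA] [Fintype TB]
  [DecidableEq EA] [DecidableEq EB] [DecidableEq Q] [DecidableEq TA] [DecidableEq TB]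
  {Ψ : Matrix (R × A × B × C) (R × A × B × C) ℂ}

/-- Amplitudes of the pure state after Alice's encoding, with the registers `Q E_B` and `R B` first,
and Alice's remaining registers and the purifying register last. -/
noncomputable def sentAmp (V : Matrix (A × Q × TA) (A × C × EA) ℂ) (θ : EA × EB → ℂ)
    (Ψ : Matrix (R × A × B × C) (R × A × B × C) ℂ) :
    Matrix ((Q × EB) × (R × B)) ((A × TA) × (R × A × B × C)) ℂ :=
  Matrix.of fun p d => ∑ x : A × C × EA,
    V (d.1.1, p.1.1, d.1.2) x * (amp Ψ (x.1, x.2.1) d.2 p.2 * θ (x.2.2, p.1.2))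

/-- The state of `Q E_B` and `R B` after Alice's encoding. -/
noncomputable def sentState (V : Matrix (A × Q × TA) (A × C × EA) ℂ) (θ : EA × EB → ℂ)
    (Ψ : Matrix (R × A × B × C) (R × A × B × C) ℂ) :
    Matrix ((Q × EB) × (R × B)) ((Q × EB) × (R × B)) ℂ :=
  sentAmp V θ Ψ * (sentAmp V θ Ψ)ᴴ

variable {V : Matrix (A × Q × TA) (A × C × EA) ℂ} {W : Matrix (B × C × TB) (Q × B × EB) ℂ}
  {θ : EA × EB → ℂ}

theorem sentState_nonneg : 0 ≤ sentState V θ Ψ := self_mul_conjTranspose_nonneg _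

/-- Alice's encoding does not touch `R B`. -/
theorem sentState_marginal (hΨ : IsState Ψ) (hV : IsIsometry V) (hθ : IsUnitVector θ) :
    marginal (fun h y => (y, h)) (sentState V θ Ψ) = margRB Ψ := by
  ext h h'
  have e1 : marginal (fun h y => (y, h)) (sentState V θ Ψ) h h'
      = ∑ p : EB × (R × A × B × C), ∑ y : A × Q × TA,
        (∑ x : A × C × EA, V y x * (amp Ψ (x.1, x.2.1) p.2 h * θ (x.2.2, p.1)))
          * star (∑ x : A × C × EA, V y x * (amp Ψ (x.1, x.2.1) p.2 h' * θ (x.2.2, p.1))) := by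
    simp only [marginal_apply, sentState, Matrix.mul_apply]
    rw [← Fintype.sum_prod_type', ← Fintype.sum_prod_type']
    exact Fintype.sum_equiv (⟨fun z => ((z.1.2, z.2.2), (z.2.1.1, z.1.1, z.2.1.2)),
      fun z => ((z.2.2.1, z.1.1), ((z.2.1, z.2.2.2), z.1.2)), fun _ => rfl, fun _ => rfl⟩ :
      (Q × EB) × ((A × TA) × (R × A × B × C)) ≃ (EB × (R × A × B × C)) × (A × Q × TA)) _ _
      fun _ => rfl
  rw [e1]
  simp only [sum_isometry_mul_star hV]
  have e2 : ∑ p : EB × (R × A × B × C), ∑ x : A × C × EA,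
      amp Ψ (x.1, x.2.1) p.2 h * θ (x.2.2, p.1) * star (amp Ψ (x.1, x.2.1) p.2 h' * θ (x.2.2, p.1))
      = (∑ e, ∑ x, amp Ψ x e h * star (amp Ψ x e h')) * ∑ t, θ t * star (θ t) := by
    rw [← Fintype.sum_prod_type', ← Fintype.sum_prod_type', Finset.sum_mul_sum,
      ← Fintype.sum_prod_type']
    exact Fintype.sum_equiv (⟨fun z => ((z.1.2, (z.2.1, z.2.2.1)), (z.2.2.2, z.1.1)),
      fun z => ((z.2.2, z.1.1), (z.1.2.1, z.1.2.2, z.2.1)), fun _ => rfl, fun _ => rfl⟩ :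
      (EB × (R × A × B × C)) × (A × C × EA) ≃ ((R × A × B × C) × (A × C)) × (EA × EB)) _ _
      fun z => by simp only [Equiv.coe_fn_mk, star_mul']; ring
  rw [e2, sum_amp_margRB hΨ, hθ.sum_mul_star, mul_one]

theorem sentState_trace (hΨ : IsState Ψ) (hV : IsIsometry V) (hθ : IsUnitVector θ) :
    (sentState V θ Ψ).trace = 1 := by
  rw [← (margRB_isState hΨ).trace_eq_one, ← sentState_marginal hΨ hV hθ]
  exact (trace_marginal (Equiv.prodComm (R × B) (Q × EB)) _).symm

/-- Bob's decoding isometry, acting on `Q E_B` and `R B`. -/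
noncomputable def bobIso (R : Type u) [DecidableEq R] (W : Matrix (B × C × TB) (Q × B × EB) ℂ) :
    Matrix (R × (B × C × TB)) ((Q × EB) × (R × B)) ℂ :=
  ((1 : Matrix R R ℂ) ⊗ₖ W).submatrix id fun p => (p.2.1, (p.1.1, p.2.2, p.1.2))

/-- The state of `R B C` after Bob's decoding of a state of `Q E_B` and `R B`. -/
noncomputable def bobOut (W : Matrix (B × C × TB) (Q × B × EB) ℂ)
    (Ξ : Matrix ((Q × EB) × (R × B)) ((Q × EB) × (R × B)) ℂ) :
    Matrix (R × B × C) (R × B × C) ℂ :=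
  marginal (fun (x : R × B × C) (t : TB) => (x.1, (x.2.1, x.2.2, t)))
    (bobIso R W * Ξ * (bobIso R W)ᴴ)

/-- Separates `R` from the registers on which Bob's decoding acts. -/
def glueBob : (Q × EB) × (R × B) ≃ R × (Q × B × EB) where
  toFun p := (p.2.1, (p.1.1, p.2.2, p.1.2))
  invFun p := ((p.2.1, p.2.2.2), (p.1, p.2.2.1))

theorem bobIso_isometry (hW : IsIsometry W) : (bobIso R W)ᴴ * bobIso R W = 1 := by
  have h : (bobIso R W)ᴴ * bobIso R W
      = (((1 : Matrix R R ℂ) ⊗ₖ W)ᴴ * ((1 : Matrix R R ℂ) ⊗ₖ W)).submatrix glueBob glueBob := rfl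
  rw [h, Matrix.conjTranspose_kronecker, ← Matrix.mul_kronecker_mul, hW, Matrix.conjTranspose_one,
    Matrix.one_mul, Matrix.one_kronecker_one, Matrix.submatrix_one_equiv]

theorem bobIso_mul_apply {k : Type*} (S : Matrix ((Q × EB) × (R × B)) k ℂ) (r : R)
    (z : B × C × TB) (d : k) :
    (bobIso R W * S) (r, z) d = ∑ x : Q × B × EB, W z x * S ((x.1, x.2.2), (r, x.2.1)) d := by
  rw [Matrix.mul_apply, ← Equiv.sum_comp (glueBob (R := R) (B := B) (Q := Q) (EB := EB)).symm]
  simp only [Fintype.sum_prod_type, bobIso, Matrix.submatrix_apply, id_eq,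
    Matrix.kroneckerMap_apply, Matrix.one_apply, glueBob, Equiv.coe_fn_symm_mk, ite_mul, one_mul,
    zero_mul, Finset.sum_ite_irrel, Finset.sum_const_zero, Finset.sum_ite_eq, Finset.mem_univ,
    if_true]

theorem finalState_apply (hΨ : IsState Ψ) (x x' : R × A × B × C) :
    finalState V W θ Ψ x x' = ∑ t : TA × TB, ∑ e : R × A × B × C,
      (bobIso R W * sentAmp V θ Ψ) (x.1, (x.2.2.1, x.2.2.2, t.2)) ((x.2.1, t.1), e)
        * star ((bobIso R W * sentAmp V θ Ψ) (x'.1, (x'.2.2.1, x'.2.2.2, t.2))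
            ((x'.2.1, t.1), e)) := by
  let S : Matrix ((A × C × EA) × (R × B × EB)) (R × A × B × C) ℂ := Matrix.of fun x e =>
    amp Ψ (x.1.1, x.1.2.1) e (x.2.1, x.2.2.1) * θ (x.1.2.2, x.2.2.2)
  let N : Matrix ((Q × B × EB) × (R × A × TA)) (R × A × B × C) ℂ := Matrix.of fun x e =>
    sentAmp V θ Ψ ((x.1.1, x.1.2.2), (x.2.1, x.1.2.1)) ((x.2.2.1, x.2.2.2), e)
  have h1 : (Ψ ⊗ₖ ketbra θ).submatrix
      (fun x : (A × C × EA) × (R × B × EB) =>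
        ((x.2.1, x.1.1, x.2.2.1, x.1.2.1), (x.1.2.2, x.2.2.2)))
      (fun x => ((x.2.1, x.1.1, x.2.2.1, x.1.2.1), (x.1.2.2, x.2.2.2))) = S * Sᴴ := by
    ext z z'
    simp only [Matrix.submatrix_apply, Matrix.kroneckerMap_apply, ketbra, Matrix.vecMulVec_apply,
      Pi.star_apply, Matrix.mul_apply, Matrix.conjTranspose_apply, S, Matrix.of_apply]
    rw [← sum_amp_mul_star hΨ (z.1.1, z.1.2.1) (z'.1.1, z'.1.2.1) (z.2.1, z.2.2.1)
      (z'.2.1, z'.2.2.1), Finset.sum_mul]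
    exact Finset.sum_congr rfl fun e _ => by rw [star_mul']; ring
  have h2 : (applyLeft V (S * Sᴴ)).submatrix
      (fun x : (Q × B × EB) × (R × A × TA) =>
        ((x.2.2.1, x.1.1, x.2.2.2), (x.2.1, x.1.2.1, x.1.2.2)))
      (fun x => ((x.2.2.1, x.1.1, x.2.2.2), (x.2.1, x.1.2.1, x.1.2.2))) = N * Nᴴ := by
    ext z z'
    rw [Matrix.submatrix_apply, applyLeft_gram_apply]
    rfl
  rw [finalState, h1, h2, marginal_apply]
  refine Finset.sum_congr rfl fun t _ => ?_
  rw [applyLeft_gram_apply]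
  refine Finset.sum_congr rfl fun e _ => ?_
  rw [bobIso_mul_apply, bobIso_mul_apply]
  rfl

/-- Alice's part of the final state is irrelevant to `R B C`: these registers are Bob's output. -/
theorem margRBC_finalState (hΨ : IsState Ψ) :
    margRBC (finalState V W θ Ψ) = bobOut W (sentState V θ Ψ) := by
  ext x x'
  have h : bobIso R W * sentState V θ Ψ * (bobIso R W)ᴴ
      = (bobIso R W * sentAmp V θ Ψ) * (bobIso R W * sentAmp V θ Ψ)ᴴ := by
    rw [sentState, Matrix.conjTranspose_mul]
    simp only [Matrix.mul_assoc]
  simp only [margRBC, bobOut, marginal_apply, finalState_apply hΨ, h]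
  simp only [Matrix.mul_apply (M := bobIso R W * sentAmp V θ Ψ), Matrix.conjTranspose_apply]
  rw [← Fintype.sum_prod_type', ← Fintype.sum_prod_type', ← Fintype.sum_prod_type']
  exact Fintype.sum_equiv (⟨fun z => (z.1.2.2, ((z.1.1, z.1.2.1), z.2)),
    fun z => ((z.2.1.1, (z.2.1.2, z.1)), z.2.2), fun _ => rfl, fun _ => rfl⟩ :
    (A × (TA × TB)) × (R × A × B × C) ≃ TB × ((A × TA) × (R × A × B × C))) _ _ fun _ => rfl

theorem finalState_isState (hΨ : IsState Ψ) (hV : IsIsometry V) (hW : IsIsometry W)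
    (hθ : IsUnitVector θ) : IsState (finalState V W θ Ψ) := by
  constructor
  · rw [← Matrix.nonneg_iff_posSemidef]
    let Z : Matrix (R × A × B × C) ((TA × TB) × (R × A × B × C)) ℂ := Matrix.of fun x d =>
      (bobIso R W * sentAmp V θ Ψ) (x.1, (x.2.2.1, x.2.2.2, d.1.2)) ((x.2.1, d.1.1), d.2)
    have h : finalState V W θ Ψ = Z * Zᴴ := by
      ext x x'
      rw [finalState_apply hΨ, ← Fintype.sum_prod_type']
      rfl
    rw [h]
    exact self_mul_conjTranspose_nonneg Z
  · rw [← trace_marginal glueRBC, ← margRBC_eq, margRBC_finalState hΨ, bobOut]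
    refine (trace_marginal (⟨fun x => (x.1.1, (x.1.2.1, x.1.2.2, x.2)),
      fun x => ((x.1, x.2.1, x.2.2.1), x.2.2.2), fun _ => rfl, fun _ => rfl⟩ :
      (R × B × C) × TB ≃ R × (B × C × TB)) _).trans ?_
    rw [Matrix.trace_mul_comm, ← Matrix.mul_assoc, bobIso_isometry hW, Matrix.one_mul,
      sentState_trace hΨ hV hθ]

/-- If the content of `R` is in a product state with the rest, then so it is after Bob's
decoding. -/
theorem exists_bobOut_kronecker (hW : IsIsometry W) {τ : Matrix (Q × EB) (Q × EB) ℂ} (hτ : 0 ≤ τ)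
    (ρR : Matrix R R ℂ) {ρB : Matrix B B ℂ} (hB : 0 ≤ ρB) :
    ∃ σ : Matrix (B × C) (B × C) ℂ, 0 ≤ σ ∧ σ.trace = τ.trace * ρB.trace ∧
      bobOut W (τ ⊗ₖ (ρR ⊗ₖ ρB)) = ρR ⊗ₖ σ := by
  let e : Q × B × EB ≃ (Q × EB) × B := ⟨fun x => ((x.1, x.2.2), x.2.1),
    fun x => (x.1.1, x.2, x.1.2), fun _ => rfl, fun _ => rfl⟩
  let ω : Matrix (Q × B × EB) (Q × B × EB) ℂ := (τ ⊗ₖ ρB).submatrix e e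
  have hω : 0 ≤ ω := submatrix_nonneg e (Matrix.nonneg_iff_posSemidef.2
    ((Matrix.nonneg_iff_posSemidef.1 hτ).kronecker (Matrix.nonneg_iff_posSemidef.1 hB)))
  have hout : bobIso R W * (τ ⊗ₖ (ρR ⊗ₖ ρB)) * (bobIso R W)ᴴ = ρR ⊗ₖ (W * ω * Wᴴ) := by
    rw [← one_kronecker_mul_kronecker_mul]
    have h1 : τ ⊗ₖ (ρR ⊗ₖ ρB) = (ρR ⊗ₖ ω).submatrix glueBob glueBob := by
      ext x x'
      simp only [Matrix.kroneckerMap_apply, Matrix.submatrix_apply, ω, e, glueBob, Equiv.coe_fn_mk]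
      ring
    have h2 : bobIso R W = ((1 : Matrix R R ℂ) ⊗ₖ W).submatrix id glueBob := rfl
    rw [h1, h2, Matrix.conjTranspose_submatrix, Matrix.submatrix_mul_equiv,
      Matrix.submatrix_mul_equiv, Matrix.submatrix_id_id]
  refine ⟨marginal (fun (x : B × C) (t : TB) => (x.1, x.2, t)) (W * ω * Wᴴ),
    marginal_nonneg _ (by simpa using mul_mul_conjTranspose_mono hω W), ?_, ?_⟩
  · refine (trace_marginal (Equiv.prodAssoc B C TB) _).trans ?_
    rw [Matrix.trace_mul_comm, ← Matrix.mul_assoc, show Wᴴ * W = 1 from hW, Matrix.one_mul,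
      trace_submatrix_equiv, Matrix.trace_kronecker]
  · rw [bobOut, hout]
    ext x x'
    simp only [marginal_apply, Matrix.kroneckerMap_apply, Finset.mul_sum]

/-- A test of Bob's output pulls back through his decoding to a test of its input. -/
theorem exists_bobOut_test (hW : IsIsometry W) {T : Matrix (R × B × C) (R × B × C) ℂ} (hT : 0 ≤ T)
    (hT1 : T ≤ 1) :
    ∃ T' : Matrix ((Q × EB) × (R × B)) ((Q × EB) × (R × B)) ℂ, 0 ≤ T' ∧ T' ≤ 1 ∧
      ∀ Ξ, (T' * Ξ).trace = (T * bobOut W Ξ).trace := by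
  let e : (R × B × C) × TB ≃ R × (B × C × TB) := ⟨fun x => (x.1.1, (x.1.2.1, x.1.2.2, x.2)),
      fun x => ((x.1, x.2.1, x.2.2.1), x.2.2.2), fun _ => rfl, fun _ => rfl⟩
  obtain ⟨h0, h1⟩ := kronecker_one_submatrix_mem_effects e hT hT1
  obtain ⟨h2, h3⟩ := conjTranspose_mul_mul_mem_effects (L := bobIso R W) h0 h1
    (bobIso_isometry hW).le
  refine ⟨_, h2, h3, fun Ξ => ?_⟩
  rw [trace_conjTranspose_mul_mul_mul, ← trace_mul_marginal e]
  rfl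

end Redistribution

/-! ### From a protocol to a simulation -/

section Communication

variable {R A B C : Type u} [Fintype R] [Fintype A] [Fintype B] [Fintype C]
  [DecidableEq R] [DecidableEq A] [DecidableEq B] [DecidableEq C]
  {Ψ : Matrix (R × A × B × C) (R × A × B × C) ℂ} {q η : ℝ}

/-- Regroups Bob's shared registers and the message into the tested system and the slots. -/
def glueReceived {EB Q F : Type u} : (EB × F) × Q ≃ (Q × EB) × F where
  toFun y := ((y.2, y.1.1), y.1.2)
  invFun x := ((x.1.2, x.2), x.1.1)

/-- With copies of the purification of `Ψ` as the shared state, Bob ends up with the encoded state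
in the chosen slot, and with a fresh marginal of `Ψ` in every other slot. -/
theorem received_copies (hΨ : IsState Ψ) (P : Protocol Ψ q η) {ι : Type} [Fintype ι]
    [DecidableEq ι] (s : ι) :
    P.received (copies ι Ψ) s
      = (atSlot s (sentState P.V P.θ Ψ) (margRB Ψ)).submatrix glueReceived glueReceived := by
  let S : Matrix ((A × C × P.EA) × (({i : ι // i ≠ s} → A × C) × (ι → R × A × B × C)) ×
      (P.EB × (ι → R × B))) Unit ℂ := Matrix.of fun x _ =>
    P.θ (x.1.2.2, x.2.2.1) * copies ι Ψ
      (((Equiv.funSplitAt s (A × C)).symm ((x.1.1, x.1.2.1), x.2.1.1), x.2.1.2), x.2.2.2)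
  have h1 : (ketbra P.θ ⊗ₖ ketbra (copies ι Ψ)).submatrix
      (fun x : (A × C × P.EA) × (({i : ι // i ≠ s} → A × C) × (ι → R × A × B × C)) ×
        (P.EB × (ι → R × B)) => ((x.1.2.2, x.2.2.1),
        (((Equiv.funSplitAt s (A × C)).symm ((x.1.1, x.1.2.1), x.2.1.1), x.2.1.2), x.2.2.2)))
      (fun x => ((x.1.2.2, x.2.2.1),
        (((Equiv.funSplitAt s (A × C)).symm ((x.1.1, x.1.2.1), x.2.1.1), x.2.1.2), x.2.2.2)))
      = S * Sᴴ := by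
    ext z z'
    simp only [Matrix.submatrix_apply, Matrix.kroneckerMap_apply, ketbra, Matrix.vecMulVec_apply,
      Pi.star_apply, Matrix.mul_apply, Matrix.conjTranspose_apply, S, Matrix.of_apply,
      Finset.univ_unique, Finset.sum_singleton, star_mul']
    ring
  have h2 : ∀ (y : (P.EB × (ι → R × B)) × P.Q) (d : A × P.TA) (r : {i : ι // i ≠ s} → A × C)
      (g : ι → R × A × B × C),
      ∑ x, P.V (d.1, y.2, d.2) x * S (x, ((r, g), y.1)) ()
        = sentAmp P.V P.θ Ψ ((y.2, y.1.1), y.1.2 s) (d, g s)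
          * ∏ i : {i // i ≠ s}, amp Ψ (r i) (g i) (y.1.2 i) := by
    intro y d r g
    rw [sentAmp, Matrix.of_apply, Finset.sum_mul]
    refine Finset.sum_congr rfl fun x _ => ?_
    simp only [S, Matrix.of_apply, copies_split]
    ring
  ext y y'
  rw [Protocol.received, h1, marginal_apply, Matrix.submatrix_apply, atSlot_apply]
  simp only [applyLeft_gram_apply, Finset.univ_unique, Finset.sum_singleton]
  have h3 : ∀ d : (A × P.TA) × (({i : ι // i ≠ s} → A × C) × (ι → R × A × B × C)),
      (∑ x, P.V (d.1.1, y.2, d.1.2) x * S (x, (d.2, y.1)) default)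
        * star (∑ x, P.V (d.1.1, y'.2, d.1.2) x * S (x, (d.2, y'.1)) default)
      = (sentAmp P.V P.θ Ψ ((y.2, y.1.1), y.1.2 s) (d.1, d.2.2 s)
          * star (sentAmp P.V P.θ Ψ ((y'.2, y'.1.1), y'.1.2 s) (d.1, d.2.2 s)))
        * ((∏ i : {i // i ≠ s}, amp Ψ (d.2.1 i) (d.2.2 i) (y.1.2 i))
          * star (∏ i : {i // i ≠ s}, amp Ψ (d.2.1 i) (d.2.2 i) (y'.1.2 i))) := by
    rintro ⟨d, r, g⟩
    have e1 := h2 y d r g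
    have e2 := h2 y' d r g
    simp only at e1 e2 ⊢
    rw [show (default : Unit) = () from rfl, e1, e2, star_mul']
    ring
  rw [Finset.sum_congr rfl fun d _ => h3 d]
  have h4 : (sentState P.V P.θ Ψ) ((y.2, y.1.1), y.1.2 s) ((y'.2, y'.1.1), y'.1.2 s)
      = ∑ e, ∑ d, sentAmp P.V P.θ Ψ ((y.2, y.1.1), y.1.2 s) (d, e)
          * star (sentAmp P.V P.θ Ψ ((y'.2, y'.1.1), y'.1.2 s) (d, e)) := by
    rw [sentState, Matrix.mul_apply, Fintype.sum_prod_type, Finset.sum_comm]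
    rfl
  have h5 : ∀ i : {i : ι // i ≠ s}, margRB Ψ (y.1.2 i) (y'.1.2 i)
      = ∑ e, ∑ x, amp Ψ x e (y.1.2 i) * star (amp Ψ x e (y'.1.2 i)) := fun i =>
    (sum_amp_margRB hΨ _ _).symm
  simp only [glueReceived, Equiv.coe_fn_mk, h4, h5]
  rw [← sum_mul_prod_subtype_ne s
    (fun e => ∑ d, sentAmp P.V P.θ Ψ ((y.2, y.1.1), y.1.2 s) (d, e)
          * star (sentAmp P.V P.θ Ψ ((y'.2, y'.1.1), y'.1.2 s) (d, e)))
    (fun i e => ∑ x, amp Ψ x e (y.1.2 i) * star (amp Ψ x e (y'.1.2 i)))]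
  have h6 : ∀ g : ι → R × A × B × C,
      (∑ d, sentAmp P.V P.θ Ψ ((y.2, y.1.1), y.1.2 s) (d, g s)
          * star (sentAmp P.V P.θ Ψ ((y'.2, y'.1.1), y'.1.2 s) (d, g s)))
        * ∏ i : {i // i ≠ s}, ∑ x, amp Ψ x (g i) (y.1.2 i) * star (amp Ψ x (g i) (y'.1.2 i))
      = ∑ d, ∑ r : {i : ι // i ≠ s} → A × C,
        (sentAmp P.V P.θ Ψ ((y.2, y.1.1), y.1.2 s) (d, g s)
          * star (sentAmp P.V P.θ Ψ ((y'.2, y'.1.1), y'.1.2 s) (d, g s)))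
        * ((∏ i : {i // i ≠ s}, amp Ψ (r i) (g i) (y.1.2 i))
          * star (∏ i : {i // i ≠ s}, amp Ψ (r i) (g i) (y'.1.2 i))) := by
    intro g
    rw [← sum_copies_split, Finset.sum_mul_sum]
  rw [Finset.sum_congr rfl fun g _ => h6 g, ← Fintype.sum_prod_type', ← Fintype.sum_prod_type']
  exact Fintype.sum_equiv (⟨fun z => ((z.2.2, z.1), z.2.1), fun z => (z.1.2, (z.2, z.1.1)),
    fun _ => rfl, fun _ => rfl⟩ : (A × P.TA) × (({i : ι // i ≠ s} → A × C) × (ι → R × A × B × C))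
      ≃ ((ι → R × A × B × C) × (A × P.TA)) × ({i : ι // i ≠ s} → A × C)) _ _ fun _ => rfl

/-- The hypothesis-testing and max-divergence data of `Ψ` give a test of Bob's received register and
one slot that tells the chosen slot from any other. -/
theorem Protocol.exists_slot_test (hΨ : IsState Ψ) (P : Protocol Ψ q η)
    {E : Matrix (R × B × C) (R × B × C) ℂ} (hE : 0 ≤ E) (hE1 : E ≤ 1) {e b : ℝ} (hb : 0 < b)
    (hEe : 1 - e ≤ (E * margRBC Ψ).trace.re)
    (hEb : (E * (margR Ψ ⊗ₖ margBC Ψ)).trace.re ≤ b)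
    {ρ' : Matrix (R × B) (R × B) ℂ} {δ l : ℝ} (hδ0 : 0 < δ) (hδ : δ ≤ 1 / 9)
    (hρ' : ρ' ∈ ball √δ (margRB Ψ)) (hl : 0 ≤ l)
    (hle : ρ' ≤ (l : ℂ) • (margR Ψ ⊗ₖ margB Ψ)) :
    ∃ T : Matrix ((P.Q × P.EB) × (R × B)) ((P.Q × P.EB) × (R × B)) ℂ, 0 ≤ T ∧ T ≤ 1 ∧
      1 - (e + 3 * √δ + η) ≤ (T * sentState P.V P.θ Ψ).trace.re ∧
      (T * (marginal Prod.mk (sentState P.V P.θ Ψ) ⊗ₖ margRB Ψ)).trace.re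
        ≤ 4 * l * (b / δ) := by
  have hRBC := margRBC_isState hΨ
  have hRB := margRB_isState hΨ
  have hR0 : 0 ≤ margR Ψ := marginal_nonneg _ hΨ.nonneg
  have hB0 : 0 ≤ margB Ψ := marginal_nonneg _ hΨ.nonneg
  have hB1 : (margB Ψ).trace = 1 := trace_margB_eq_trace_margRB.trans hRB.trace_eq_one
  have hτ1 := sentState_trace hΨ P.V_isometry P.θ_unit
  have hτm : (marginal Prod.mk (sentState P.V P.θ Ψ)).trace = 1 :=
    (trace_marginal (Equiv.refl _) _).trans hτ1
  obtain ⟨T₁, h₁0, h₁1, h₁e, h₁b⟩ := exists_universal_test hE hE1 hRBC.nonneg hRBC.trace_re hR0 hb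
    hδ0 (by linarith) (by rwa [margBC_eq_marginal_margRBC])
  obtain ⟨T₂, h₂0, h₂1, h₂⟩ := exists_bobOut_test (EB := P.EB) (TB := P.TB) P.W_isometry h₁0 h₁1
  have hprot : (T₁ * margRBC Ψ).trace.re - η ≤ (T₂ * sentState P.V P.θ Ψ).trace.re := by
    obtain ⟨hF0, hF1⟩ := kronecker_one_submatrix_mem_effects (glueRBC (R := R) (A := A)) h₁0 h₁1
    have := test_sub_test_le_purifiedDistance'
      (finalState_isState hΨ P.V_isometry P.W_isometry P.θ_unit) hΨ hF0 hF1
    rw [← trace_mul_marginal, ← trace_mul_marginal, ← margRBC_eq, ← margRBC_eq,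
      margRBC_finalState hΨ, ← h₂] at this
    linarith [P.error_le]
  have hprod : (T₂ * (marginal Prod.mk (sentState P.V P.θ Ψ) ⊗ₖ (margR Ψ ⊗ₖ margB Ψ))).trace.re
      ≤ b / δ := by
    obtain ⟨σ, hσ0, hσ1, hσ⟩ := exists_bobOut_kronecker P.W_isometry
      (marginal_nonneg Prod.mk (sentState_nonneg (V := P.V) (θ := P.θ) (Ψ := Ψ))) (margR Ψ) hB0
    rw [h₂, hσ]
    refine (h₁b σ hσ0).trans_eq ?_
    rw [hσ1, hτm, hB1, mul_one, Complex.one_re, mul_one]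
  have : Nonempty (R × B) := by
    by_contra hne
    rw [not_nonempty_iff] at hne
    have := hRB.trace_eq_one
    simp [Matrix.trace] at this
  obtain ⟨T, hT0, hT1, hTe, hTb⟩ := exists_smoothed_test h₂0 h₂1 sentState_nonneg
    (by rw [hτ1]; rfl) (sentState_marginal hΨ P.V_isometry P.θ_unit) hRB hρ'.1 hδ0 hδ hρ'.2 hl hle
    hprod
  exact ⟨T, hT0, hT1, by linarith, hTb⟩

/-- A test of the received register and one slot gives a simulation in which every message has a
slot of its own. -/
theorem Protocol.nonempty_simulation (hΨ : IsState Ψ) (P : Protocol Ψ q η)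
    {T : Matrix ((P.Q × P.EB) × (R × B)) ((P.Q × P.EB) × (R × B)) ℂ} (hT : 0 ≤ T) (hT1 : T ≤ 1)
    {e₁ e₂ c κ N ε : ℝ} (he₁ : 1 - e₁ ≤ (T * sentState P.V P.θ Ψ).trace.re)
    (he₂ : (T * (marginal Prod.mk (sentState P.V P.θ Ψ) ⊗ₖ margRB Ψ)).trace.re ≤ e₂)
    (he₂0 : 0 ≤ e₂) (hc : 0 < c) (hκ : 0 < κ)
    (hε : (1 + c) * e₁ + (2 + c + c⁻¹) * (numMessages N * e₂ + κ) ≤ ε) :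
    Nonempty (Simulation P N ε) := by
  have hRB := margRB_isState hΨ
  have hτ1 := sentState_trace hΨ P.V_isometry P.θ_unit
  obtain ⟨Λ, hΛ0, hΛ1, hΛ⟩ := exists_slot_decoder (ι := Fin (numMessages N)) hT hT1
    sentState_nonneg hτ1 hRB.nonneg hRB.trace_eq_one he₁ he₂ he₂0 hc hκ
  rw [Fintype.card_fin] at hΛ
  let Λ' : Option (Fin (numMessages N)) → Matrix ((P.Q × P.EB) × (Fin (numMessages N) → R × B))
      ((P.Q × P.EB) × (Fin (numMessages N) → R × B)) ℂ := fun o => o.elim (1 - ∑ s, Λ s) Λ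
  have hM0 : ∀ o, 0 ≤ (Λ' o).submatrix glueReceived glueReceived := by
    intro o
    refine submatrix_nonneg _ ?_
    cases o with
    | none => exact sub_nonneg.2 hΛ1
    | some s => exact hΛ0 s
  have hM1 : ∑ o, (Λ' o).submatrix (glueReceived (EB := P.EB) (Q := P.Q)) glueReceived = 1 := by
    have : ∑ o, Λ' o = 1 := by
      rw [Fintype.sum_option]
      exact sub_add_cancel _ _
    rw [← Matrix.submatrix_one_equiv glueReceived, ← this]
    ext y y'
    simp [Matrix.sum_apply]
  have hq := measurement_isQuantumMap hM0 hM1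
  refine ⟨{ Slot := Fin (numMessages N), G := Fin (numMessages N) → R × A × B × C,
            F := Fin (numMessages N) → R × B, φ := copies _ Ψ, φ_unit := copies_isUnitVector hΨ,
            slot := id, slot_state := copies_marginal hΨ, decode := measurement _,
            decode_quantumMap := hq, error_le := fun m => ?_ }⟩
  rw [id, received_copies hΨ]
  set ξ := (atSlot m (sentState P.V P.θ Ψ) (margRB Ψ)).submatrix
    (glueReceived (EB := P.EB) (Q := P.Q)) glueReceived with hξ
  have htr : ξ.trace = 1 := by
    rw [hξ, trace_submatrix_equiv, trace_atSlot m _ hRB.trace_eq_one, hτ1]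
  have hsum : ∑ k, (measurement (fun o => (Λ' o).submatrix glueReceived glueReceived) ξ k k).re
      = 1 := by
    rw [← Complex.re_sum]
    have := hq.tracePreserving ξ
    rw [htr] at this
    exact congrArg Complex.re this
  have hm : (measurement (fun o => (Λ' o).submatrix glueReceived glueReceived) ξ
      (some m) (some m)).re = (Λ m * atSlot m (sentState P.V P.θ Ψ) (margRB Ψ)).trace.re := by
    rw [measurement_apply, Matrix.diagonal_apply_eq, hξ, Matrix.submatrix_mul_equiv,
      trace_submatrix_equiv]
    rfl
  rw [← Finset.sum_filter_add_sum_filter_not Finset.univ (fun k => k ≠ some m)] at hsum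
  have hs : (Finset.univ.filter fun k : Option (Fin (numMessages N)) => ¬ k ≠ some m)
      = {some m} := by
    ext k; simp
  rw [hs, Finset.sum_singleton, hm] at hsum
  have := (hΛ m).trans hε
  linarith

end Communication

/-! ### Real and extended real estimates -/

section Arithmetic

/-- Strict approximation of a difference of divergences, at a cost of one bit. The value
`b = ⊤` is excluded, as `a - ⊤ = ⊥` for every `a`, while `b = ⊥` is allowed. -/
theorem exists_real_of_le_sub_sub {N L : ℝ} {a b : EReal}
    (h : (N : EReal) ≤ a - b - (L : EReal)) :
    ∃ y t : ℝ, (y : EReal) < a ∧ b < (t : EReal) ∧ N ≤ y - t - L + 1 := by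
  induction b with
  | top => simp at h
  | bot =>
    induction a with
    | bot => simp at h
    | top => exact ⟨0, -L - N, EReal.coe_lt_top _, EReal.bot_lt_coe _, by linarith⟩
    | coe a => exact ⟨a - 1, a - 1 - L - N, by exact_mod_cast sub_one_lt a,
        EReal.bot_lt_coe _, by linarith⟩
  | coe b =>
    induction a with
    | bot => simp at h
    | top => exact ⟨N + (b + 1) + L, b + 1, EReal.coe_lt_top _, by exact_mod_cast lt_add_one b,
        by linarith⟩
    | coe a =>
      have h' : N ≤ a - b - L := by exact_mod_cast h
      exact ⟨a - 1 / 2, b + 1 / 2, by exact_mod_cast sub_lt_self a one_half_pos,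
        by exact_mod_cast lt_add_of_pos_right b one_half_pos, by linarith⟩

theorem le_rpow_neg_of_lt_logInv {x y : ℝ} (h : (y : EReal) < logInv x) : x ≤ (2 : ℝ) ^ (-y) := by
  rw [logInv] at h
  split_ifs at h with hx
  · exact hx.trans (by positivity)
  · push Not at hx
    have h1 : y < Real.logb 2 (1 / x) := by exact_mod_cast h
    rw [Real.lt_logb_iff_rpow_lt (by norm_num) (by positivity)] at h1
    rw [Real.rpow_neg (by norm_num)]
    rw [lt_div_iff₀ hx] at h1
    rw [← one_div, le_div_iff₀ (by positivity)]
    linarith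

theorem exists_rpow_bound {X : Type*} [Fintype X] {ρ σ : Matrix X X ℂ} {t : ℝ}
    (h : Dmax ρ σ < (t : EReal)) :
    ∃ s : ℝ, s < t ∧ ρ ≤ (((2 : ℝ) ^ s : ℝ) : ℂ) • σ := by
  obtain ⟨_, ⟨s, rfl, hs⟩, hst⟩ := sInf_lt_iff.1 h
  exact ⟨s, by exact_mod_cast hst, Matrix.le_iff.2 hs⟩

/-- The choice of parameters in the decoding error: `c = δ / ε` and `κ = δ² / 2`. The bound on `x`
has room for the factor 2 lost because the infimum and the supremum in the divergences need not be
attained. -/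
theorem decoding_error_le {ε δ e x : ℝ} (hε0 : 0 < ε) (hε1 : ε < 1) (hδ0 : 0 < δ)
    (hδ : δ ≤ ε ^ 2 / 9) (he : e ≤ ε) (hx : x ≤ 2 * δ ^ 3 / ε ^ 3) :
    (1 + δ / ε) * e + (2 + δ / ε + (δ / ε)⁻¹) * (x + δ ^ 2 / 2) ≤ ε + 2 * δ := by
  set c := δ / ε with hc
  have hc0 : 0 < c := by positivity
  have hδc : δ = c * ε := by rw [hc]; field_simp
  have hcε : 9 * c ≤ ε := by
    rw [hc, ← mul_div_assoc, div_le_iff₀ hε0]; nlinarith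
  have hx' : x ≤ 2 * c ^ 3 := by
    refine hx.trans_eq ?_
    rw [hc]; field_simp
  have h1 : (1 + c) * e ≤ ε + δ := by
    rw [hδc]; nlinarith
  have h2 : (2 + c + c⁻¹) * (x + δ ^ 2 / 2) ≤ δ := by
    have h3 : x + δ ^ 2 / 2 ≤ c ^ 2 * (13 / 18 * ε) := by
      rw [hδc]
      nlinarith [mul_le_mul_of_nonneg_left hcε (sq_nonneg c), sq_nonneg c,
        mul_pos hc0 hc0, mul_nonneg (sq_nonneg c) (mul_nonneg hε0.le (sub_nonneg.2 hε1.le))]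
    calc (2 + c + c⁻¹) * (x + δ ^ 2 / 2) ≤ (2 + c + c⁻¹) * (c ^ 2 * (13 / 18 * ε)) := by gcongr
      _ = (1 + c) ^ 2 * (13 / 18) * (c * ε) := by field_simp; ring
      _ ≤ 1 * (c * ε) := by
        gcongr
        nlinarith
      _ = δ := by rw [hδc, one_mul]
  linarith

end Arithmetic
end QSR

theorem proposition6 {R A B C : Type u} [Fintype R] [Fintype A] [Fintype B] [Fintype C]
    [DecidableEq R] [DecidableEq A] [DecidableEq B] [DecidableEq C]
    (ε δ : ℝ) (hε₀ : 0 < ε) (hε₁ : ε < 1) (hδ₀ : 0 < δ) (hδ₁ : δ < 1)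
    (Ψ : Matrix (R × A × B × C) (R × A × B × C) ℂ) (hΨ : QSR.IsState Ψ)
    (q η : ℝ) (P : QSR.Protocol Ψ q η) (N : ℝ)
    (hN : (N : EReal) ≤
      QSR.DH (ε - 3 * √δ - 3 * η) (QSR.margRBC Ψ) (QSR.margR Ψ ⊗ₖ QSR.margBC Ψ)
        - QSR.smoothDmax (√δ) (QSR.margRB Ψ) (QSR.margR Ψ ⊗ₖ QSR.margB Ψ)
        - ((Real.logb 2 (4 * ε ^ 3 / δ ^ 4) : ℝ) : EReal)) :
    Nonempty (QSR.Simulation P N (ε + 2 * δ)) := by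
  obtain ⟨y, t, hy, ht, hNyt⟩ := QSR.exists_real_of_le_sub_sub hN
  obtain ⟨_, ⟨E, hE0, hE1, hEe, rfl⟩, hEy⟩ := lt_sSup_iff.1 hy
  have hEb := QSR.le_rpow_neg_of_lt_logInv hEy
  simp only [QSR.smoothDmax, iInf_lt_iff] at ht
  obtain ⟨ρ', hρ', ht⟩ := ht
  obtain ⟨s, hst, hle⟩ := QSR.exists_rpow_bound ht
  have hE0' := Matrix.nonneg_iff_posSemidef.2 hE0
  have hE1' := Matrix.le_iff.2 hE1
  have hη : 0 ≤ η := (Real.sqrt_nonneg _).trans P.error_le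
  -- The existence of the test `E` forces `3 √δ ≤ ε`.
  have hδε : δ ≤ ε ^ 2 / 9 := by
    have h1 := QSR.trace_mul_re_mono_left hE1' (QSR.margRBC_isState hΨ).nonneg
    rw [Matrix.one_mul, (QSR.margRBC_isState hΨ).trace_re] at h1
    have h2 : 3 * √δ ≤ ε := by linarith
    nlinarith [Real.sq_sqrt hδ₀.le, Real.sqrt_nonneg δ]
  have hδ9 : δ ≤ 1 / 9 := by nlinarith
  obtain ⟨T, hT0, hT1, hTe, hTb⟩ := P.exists_slot_test hΨ hE0' hE1' (by positivity) hEe hEb hδ₀ hδ9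
    hρ' (by positivity) hle
  refine P.nonempty_simulation hΨ hT0 hT1 hTe hTb (by positivity) (by positivity : 0 < δ / ε)
    (by positivity : 0 < δ ^ 2 / 2)
    (QSR.decoding_error_le hε₀ hε₁ hδ₀ hδε (by linarith) ?_)
  have hM : (QSR.numMessages N : ℝ) ≤ 2 ^ N := Nat.floor_le (by positivity)
  have hK : (2 : ℝ) ^ N * 2 ^ s * 2 ^ (-y) ≤ 2 * (δ ^ 4 / (4 * ε ^ 3)) := by
    rw [← Real.rpow_add two_pos, ← Real.rpow_add two_pos]
    have hL : (2 : ℝ) ^ (-Real.logb 2 (4 * ε ^ 3 / δ ^ 4)) = δ ^ 4 / (4 * ε ^ 3) := by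
      rw [Real.rpow_neg two_pos.le, Real.rpow_logb two_pos (by norm_num) (by positivity), inv_div]
    calc (2 : ℝ) ^ (N + s + -y) ≤ 2 ^ (1 + -Real.logb 2 (4 * ε ^ 3 / δ ^ 4)) :=
          Real.rpow_le_rpow_of_exponent_le one_le_two (by linarith)
      _ = _ := by rw [Real.rpow_add two_pos, Real.rpow_one, hL]
  calc (QSR.numMessages N : ℝ) * (4 * 2 ^ s * (2 ^ (-y) / δ))
      ≤ 2 ^ N * (4 * 2 ^ s * (2 ^ (-y) / δ)) := by gcongr
    _ = 4 / δ * (2 ^ N * 2 ^ s * 2 ^ (-y)) := by ring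
    _ ≤ 4 / δ * (2 * (δ ^ 4 / (4 * ε ^ 3))) := by gcongr
    _ = 2 * δ ^ 3 / ε ^ 3 := by field_simp
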